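/- **Setting.** Let $\mathcal L$ be a language of propositional logic whose prime sentences (atoms) form a decidable set of finite strings, and let $\mathcal S$ be the set of its sentences, built with $\lnot,\land,\lor,\to,\leftrightarrow$. A *world* is a map $W:\mathcal S\to\{0,1\}$; it is *propositionally consistent* if it respects the connectives, and for a set $\Delta\subseteq\mathcal S$ we write $\mathcal{PC}(\Delta)$ for the set of propositionally consistent worlds $W$ with $W(\phi)=1$ for all $\phi\in\Delta$. Let $\Gamma\subseteq\mathcal S$ be computably enumerable and consistent, i.e. $\mathcal{PC}(\Gamma)\neq\emptyset$. A *market* is a computable sequence $\overline{\mathbb P}=(\mathbb P_1,\mathbb P_2,\dots)$ of maps $\mathbb P_n:\mathcal S\to\mathbb Q\cap[0,1]$. A *deductive process* is a computable sequence $D_1\subseteq D_2\subseteq\cdots$ of finite subsets of $\mathcal S$; it is *$\Gamma$-complete* if $\mathcal{PC}(\bigcup_nD_n)=\mathcal{PC}(\Gamma)$. An *expressible feature of rank $\le n$* is a function of valuation sequences $\overline{\mathbb V}=(\mathbb V_1,\mathbb V_2,\dots)$, $\mathbb V_i:\mathcal S\to[0,1]$, written as an expression built from prices $\phi^{*i}:\overline{\mathbb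 V}\mapsto\mathbb V_i(\phi)$ with $i\le n$, rational numbers, $+$, $\cdot$, $\max$ and $\xi\mapsto 1/\max(1,\xi)$, where successive definitions of variables $v_1:=\dots,\ v_2:=\dots$ may be used to abbreviate subexpressions. A *trading strategy for day $n$* is a finite list of pairs $(\phi_j,\xi_j)$ with $\phi_j\in\mathcal S$ and $\xi_j$ an expressible feature of rank $\le n$ (the features of a strategy may share variable definitions); on $\overline{\mathbb V}$ its value in a world $W$ is $\sum_j\xi_j(\overline{\mathbb V})\,(W(\phi_j)-\mathbb V_n(\phi_j))$. A *trader* is a sequence $\overline T$ with $T_n$ a trading strategy for day $n$; it is *efficiently computable* if a Turing machine, given $n$ in unary, writes down $T_n$ in time polynomial in $n$. The trader *exploits* $\overline{\mathbb P}$ relative to $\overline D$ if the set of values $W\big(\sum_{i\le n}T_i(\overline{\mathbb P})\big)$, over all $n\ge1$ and all $W\in\mathcal{PC}(D_n)$, is bounded below but not bounded above. A market is a *logical inductor over $\Gamma$* if for some $\Gamma$-complete deductive process $\overline D$ no efficiently computable trader exploits it relative to $\overline D$. A *continuous semimeasure* is a function $\mu:\{0,1\}^*\to[0,\infty)$ with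 $\mu(\text{empty string})\le1$ and $\mu(\sigma0)+\mu(\sigma1)\le\mu(\sigma)$ for all $\sigma$. It is *lower semicomputable* if there are rational numbers $a(\sigma,k)\ge0$, computable from $\sigma$ and $k$ and nondecreasing in $k$, with $\lim_ka(\sigma,k)=\mu(\sigma)$. A *universal continuous semimeasure* is a lower semicomputable continuous semimeasure $M$ such that for every lower semicomputable continuous semimeasure $\mu$ there is $c>0$ with $M(\sigma)\ge c\,\mu(\sigma)$ for all $\sigma$. **Theorem (Strict domination of the universal semimeasure).** Let $\overline{\mathbb P}$ be a logical inductor over $\Gamma$, let $b_1,b_2,\dots$ be a computable sequence of distinct prime sentences of $\mathcal L$ none of which occurs in a sentence of $\Gamma$, and let $M$ be a universal continuous semimeasure. The limit $\mathbb P_\infty(\phi):=\lim_{n\to\infty}\mathbb P_n(\phi)$ exists for every $\phi\in\mathcal S$. For a nonempty finite bitstring $\sigma=\sigma_1\cdots\sigma_n$ put $\mathbb P_\infty(\sigma):=\mathbb P_\infty(\ell_1\land\dots\land\ell_n)$, where $\ell_i$ is $b_i$ if $\sigma_i=1$ and $\lnot b_i$ if $\sigma_i=0$. Then $M$ does not dominate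 $\mathbb P_\infty$: for every real $C>0$ there is a nonempty finite bitstring $\sigma$ with $$\mathbb P_\infty(\sigma)>C\cdot M(\sigma).$$ -/

import Mathlib

namespace LogicalInduction

open Filter Topology

/-! ### Strings -/

/-- The finite alphabet in which sentences, features and trading strategies are written. -/
inductive Token where
  | zero | one | done
  | prime | neg | and | or | imp | iff
  | price | rat | var | add | mul | max | recip
  | define | trade
  deriving DecidableEq

/-- The numbering of the alphabet. -/
def Token.equivFin : Token ≃ Fin 18 where
  toFun s := ⟨s.ctorIdx, by cases s <;> decide⟩
  invFun i := Token.ofNat i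
  left_inv s := by cases s <;> rfl
  right_inv i := by revert i; decide

instance : Fintype Token := Fintype.ofEquiv (Fin 18) Token.equivFin.symm

instance : Primcodable Token := Primcodable.ofEquiv (Fin 18) Token.equivFin

/-- A bit as a letter. -/
def bitCode (x : Bool) : Token := if x then Token.one else Token.zero

/-- A natural number in binary, closed by a delimiter. -/
def natCode (n : ℕ) : List Token :=
  (Computability.encodeNat n).map bitCode ++ [Token.done]

/-- A natural number in unary, closed by a delimiter. -/
def unaryCode (n : ℕ) : List Token :=
  List.replicate n Token.one ++ [Token.done]

/-- A rational number: sign, numerator and denominator in lowest terms, in binary. -/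
def ratCode (q : ℚ) : List Token :=
  bitCode (decide (q < 0)) :: (natCode q.num.natAbs ++ natCode q.den)

/-! ### Languages, sentences, worlds -/

/-- A language of propositional logic, given by a decidable set of finite binary strings:
the prime sentences (propositional atoms) of the language, as they are written. -/
structure PropLanguage where
  prime : Set (List Bool)
  prime_computable : ComputablePred (fun s : List Bool => s ∈ prime)

/-- The sentences of a language: Boolean combinations of prime sentences. -/
inductive Sentence (L : PropLanguage) : Type where
  | prime (p : L.prime) : Sentence L
  | neg (φ : Sentence L) : Sentence L
  | and (φ ψ : Sentence L) : Sentence L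
  | or (φ ψ : Sentence L) : Sentence L
  | imp (φ ψ : Sentence L) : Sentence L
  | iff (φ ψ : Sentence L) : Sentence L

variable {L : PropLanguage}

/-- The string of a sentence, in Polish notation. -/
def Sentence.code : Sentence L → List Token
  | .prime p => Token.prime :: ((p : List Bool).map bitCode ++ [Token.done])
  | .neg φ => Token.neg :: φ.code
  | .and φ ψ => Token.and :: (φ.code ++ ψ.code)
  | .or φ ψ => Token.or :: (φ.code ++ ψ.code)
  | .imp φ ψ => Token.imp :: (φ.code ++ ψ.code)
  | .iff φ ψ => Token.iff :: (φ.code ++ ψ.code)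

/-- The prime sentence `p` occurs in the sentence. -/
def Sentence.Mentions (p : L.prime) : Sentence L → Prop
  | .prime q => q = p
  | .neg φ => φ.Mentions p
  | .and φ ψ => φ.Mentions p ∨ ψ.Mentions p
  | .or φ ψ => φ.Mentions p ∨ ψ.Mentions p
  | .imp φ ψ => φ.Mentions p ∨ ψ.Mentions p
  | .iff φ ψ => φ.Mentions p ∨ ψ.Mentions p

/-- A world is any truth assignment to the sentences. -/
abbrev World (L : PropLanguage) : Type := Sentence L → Bool

/-- Propositional consistency of a world: truth values respect the connectives. -/
structure World.IsPC (W : World L) : Prop where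
  neg : ∀ φ, W (.neg φ) = !(W φ)
  and : ∀ φ ψ, W (.and φ ψ) = (W φ && W ψ)
  or : ∀ φ ψ, W (.or φ ψ) = (W φ || W ψ)
  imp : ∀ φ ψ, W (.imp φ ψ) = (!(W φ) || W ψ)
  iff : ∀ φ ψ, W (.iff φ ψ) = (W φ == W ψ)

/-- The worlds propositionally consistent with a set of sentences. -/
def pcWorlds (Δ : Set (Sentence L)) : Set (World L) :=
  {W | W.IsPC ∧ ∀ φ ∈ Δ, W φ = true}

/-- Consistency of a propositional theory: some world is consistent with it. -/
def Consistent (Γ : Set (Sentence L)) : Prop := (pcWorlds Γ).Nonempty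

/-- Computable enumerability of a set of sentences. -/
def IsCE (Γ : Set (Sentence L)) : Prop :=
  REPred fun s : List Token => ∃ φ ∈ Γ, φ.code = s

/-! ### Markets and deductive processes (days are numbered from `0`) -/

/-- A market: a computable sequence of valuations with values in `ℚ ∩ [0, 1]`.
Computability means that a numerator and a denominator of the price can be computed from the day
and the string of the sentence. -/
def IsMarket (P : ℕ → Sentence L → ℚ) : Prop :=
  (∀ n φ, 0 ≤ P n φ ∧ P n φ ≤ 1) ∧
  ∃ f : ℕ × List Token → ℕ × ℕ, Computable f ∧
    ∀ n φ, P n φ = ((f (n, φ.code)).1 : ℚ) / ((f (n, φ.code)).2 : ℚ)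

/-- A deductive process: a computable nested sequence of finite sets of sentences. -/
def IsDeductiveProcess (D : ℕ → Finset (Sentence L)) : Prop :=
  Monotone D ∧
  ∃ d : ℕ → List (List Token), Computable d ∧ ∀ n s, s ∈ d n ↔ ∃ φ ∈ D n, φ.code = s

/-- `D` is `Γ`-complete: the union of the `D n` has the same consistent worlds as `Γ`. -/
def IsComplete (D : ℕ → Finset (Sentence L)) (Γ : Set (Sentence L)) : Prop :=
  pcWorlds (⋃ n, (D n : Set (Sentence L))) = pcWorlds Γ

/-! ### Expressible features and traders -/

/-- Feature expressions, with variables (`var j` is the value of the `j`-th definition, counted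
from `0`, of the program in which the expression stands). -/
inductive Feature (L : PropLanguage) : Type where
  | price (day : ℕ) (φ : Sentence L) : Feature L
  | rat (q : ℚ) : Feature L
  | var (j : ℕ) : Feature L
  | add (ξ ζ : Feature L) : Feature L
  | mul (ξ ζ : Feature L) : Feature L
  | max (ξ ζ : Feature L) : Feature L
  | recip (ξ : Feature L) : Feature L

/-- Value of a feature expression on a valuation sequence, given the values of the variables. -/
noncomputable def Feature.eval (V : ℕ → Sentence L → ℝ) (env : List ℝ) : Feature L → ℝ
  | .price i φ => V i φ
  | .rat q => (q : ℝ)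
  | .var j => env.getD j 0
  | .add ξ ζ => ξ.eval V env + ζ.eval V env
  | .mul ξ ζ => ξ.eval V env * ζ.eval V env
  | .max ξ ζ => Max.max (ξ.eval V env) (ζ.eval V env)
  | .recip ξ => (Max.max 1 (ξ.eval V env))⁻¹

/-- The expression looks only at prices of days `≤ n` and uses only the first `k` variables. -/
def Feature.WellFormed (n k : ℕ) : Feature L → Prop
  | .price i _ => i ≤ n
  | .rat _ => True
  | .var j => j < k
  | .add ξ ζ => ξ.WellFormed n k ∧ ζ.WellFormed n k
  | .mul ξ ζ => ξ.WellFormed n k ∧ ζ.WellFormed n k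
  | .max ξ ζ => ξ.WellFormed n k ∧ ζ.WellFormed n k
  | .recip ξ => ξ.WellFormed n k

/-- The string of a feature expression, in Polish notation. -/
def Feature.code : Feature L → List Token
  | .price i φ => Token.price :: (unaryCode i ++ φ.code)
  | .rat q => Token.rat :: ratCode q
  | .var j => Token.var :: unaryCode j
  | .add ξ ζ => Token.add :: (ξ.code ++ ζ.code)
  | .mul ξ ζ => Token.mul :: (ξ.code ++ ζ.code)
  | .max ξ ζ => Token.max :: (ξ.code ++ ζ.code)
  | .recip ξ => Token.recip :: ξ.code

/-- A trading strategy as it is written down: definitions of variables `v₀, v₁, …`, followed by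
orders `(φᵢ, ξᵢ)`, each of which means "buy `ξᵢ` shares of `φᵢ` at the current price". -/
structure Strategy (L : PropLanguage) : Type where
  defs : List (Feature L)
  orders : List (Sentence L × Feature L)

namespace Strategy

/-- The strategy is a strategy for day `n`: all features have rank at most `n`, each definition
uses only earlier variables, and the orders use only variables that have been defined. -/
def WellFormed (n : ℕ) (T : Strategy L) : Prop :=
  (∀ (k : ℕ) (h : k < T.defs.length), (T.defs[k]).WellFormed n k) ∧
  ∀ o ∈ T.orders, o.2.WellFormed n T.defs.length

/-- The values of the variables of the strategy, computed one after the other. -/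
noncomputable def env (V : ℕ → Sentence L → ℝ) (T : Strategy L) : List ℝ :=
  T.defs.foldl (fun e ξ => e ++ [ξ.eval V e]) []

/-- The cash term of the strategy when it is executed on day `n`: minus the cost of the orders at
the prices of that day. -/
noncomputable def cash (n : ℕ) (V : ℕ → Sentence L → ℝ) (T : Strategy L) : ℝ :=
  -(T.orders.map fun o => o.2.eval V (T.env V) * V n o.1).sum

/-- The value in the world `W` of the cash and the shares obtained on day `n`. -/
noncomputable def value (n : ℕ) (V : ℕ → Sentence L → ℝ) (W : World L) (T : Strategy L) : ℝ :=
  T.cash n V +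
    (T.orders.map fun o => o.2.eval V (T.env V) * (if W o.1 = true then 1 else 0)).sum

/-- The string of a strategy. -/
def code (T : Strategy L) : List Token :=
  T.defs.flatMap (fun ξ => Token.define :: ξ.code) ++
    T.orders.flatMap (fun o => Token.trade :: (o.1.code ++ o.2.code))

end Strategy

/-- A trader: a trading strategy for each day. -/
def IsTrader (T : ℕ → Strategy L) : Prop := ∀ n, (T n).WellFormed n

/-- Efficient computability: a Turing machine, given `n` in unary, writes the `n`-th strategy in
time polynomial in `n`. -/
def EfficientlyComputable (T : ℕ → Strategy L) : Prop :=
  Nonempty (Turing.TM2ComputableInPolyTime Computability.unaryEncodeNat Strategy.code T)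

/-- Value in the world `W` of the net holdings of a trader after day `n`. -/
noncomputable def netWorth (T : ℕ → Strategy L) (V : ℕ → Sentence L → ℝ) (n : ℕ) (W : World L) :
    ℝ :=
  ∑ i ∈ Finset.range (n + 1), (T i).value i V W

/-- The trader exploits the valuation sequence relative to the deductive process: its plausible
net worth is bounded below but not above. -/
def Exploits (T : ℕ → Strategy L) (V : ℕ → Sentence L → ℝ) (D : ℕ → Finset (Sentence L)) : Prop :=
  BddBelow {x : ℝ | ∃ n, ∃ W ∈ pcWorlds (D n : Set (Sentence L)), x = netWorth T V n W} ∧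
  ¬ BddAbove {x : ℝ | ∃ n, ∃ W ∈ pcWorlds (D n : Set (Sentence L)), x = netWorth T V n W}

/-- The logical induction criterion: `P` is a market that is exploited by no efficiently computable
trader. -/
def IsLogicalInductor (P : ℕ → Sentence L → ℚ) (D : ℕ → Finset (Sentence L)) : Prop :=
  IsMarket P ∧
  ∀ T : ℕ → Strategy L, IsTrader T → EfficientlyComputable T →
    ¬ Exploits T (fun n φ => (P n φ : ℝ)) D

/-- `P` is a logical inductor over the theory `Γ`. -/
def IsLogicalInductorOver (P : ℕ → Sentence L → ℚ) (Γ : Set (Sentence L)) : Prop :=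
  ∃ D : ℕ → Finset (Sentence L),
    IsDeductiveProcess D ∧ IsComplete D Γ ∧ IsLogicalInductor P D

/-! ### Bitstrings -/

/-- The sentence saying that the truth value of `b i` is `x`. -/
def literal (b : ℕ → L.prime) (i : ℕ) (x : Bool) : Sentence L :=
  if x then .prime (b i) else .neg (.prime (b i))

/-- The conjunction of `φ` and of the literals for `b i, b (i + 1), …` given by the bits. -/
def conjLiterals (b : ℕ → L.prime) : Sentence L → ℕ → List Bool → Sentence L
  | φ, _, [] => φ
  | φ, i, x :: σ => conjLiterals b (.and φ (literal b i x)) (i + 1) σ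

/-- The sentence saying that `b 0, b 1, …` starts with the bitstring; for the empty string this is
a tautology, in place of the empty conjunction. -/
def startsWith (b : ℕ → L.prime) : List Bool → Sentence L
  | [] => .or (.prime (b 0)) (.neg (.prime (b 0)))
  | x :: σ => conjLiterals b (literal b 0 x) 1 σ

/-! ### Universal continuous semimeasures -/

/-- A continuous semimeasure, on finite binary strings. -/
structure IsContinuousSemimeasure (μ : List Bool → ℝ) : Prop where
  nonneg : ∀ σ, 0 ≤ μ σ
  nil_le_one : μ [] ≤ 1
  append_le : ∀ σ, μ (σ ++ [false]) + μ (σ ++ [true]) ≤ μ σ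

/-- A nonnegative function is lower semicomputable: it is the limit of a computable nondecreasing
sequence of nonnegative rationals, uniformly in the argument. -/
def LowerSemicomputable (μ : List Bool → ℝ) : Prop :=
  ∃ p q : List Bool × ℕ → ℕ, Computable p ∧ Computable q ∧ ∀ σ,
    Monotone (fun k => (p (σ, k) : ℝ) / ((q (σ, k) : ℝ) + 1)) ∧
    Tendsto (fun k => (p (σ, k) : ℝ) / ((q (σ, k) : ℝ) + 1)) atTop (𝓝 (μ σ))

/-- A universal continuous semimeasure: a lower semicomputable continuous semimeasure that
dominates all of them up to a positive factor. -/
structure IsUniversalSemimeasure (M : List Bool → ℝ) : Prop where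
  semimeasure : IsContinuousSemimeasure M
  lowerSemicomputable : LowerSemicomputable M
  dominates : ∀ μ : List Bool → ℝ, IsContinuousSemimeasure μ → LowerSemicomputable μ →
    ∃ c : ℝ, 0 < c ∧ ∀ σ, c * μ σ ≤ M σ

end LogicalInduction

namespace LogicalInduction

open Turing Turing.PartrecToTM2 Turing.ToPartrec

/-! Against a lower semicomputable continuous semimeasure `M` there are uniformly computable lists
`Ψ (e, s)` of bitstrings and one infinite sequence `X` such that every list contains a prefix of
`X`, while for growing `s` the list `Ψ (e, s)` settles on one of mass at most `2 ^ (1 - e)`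
(`exists_light_lists`). Requirement `e` owns the positions `Nat.pair e j`. Whenever the current
approximation to `M` shows a mass above `2 ^ (-e)` on its strings, it fixes its next bit so as to
keep the lighter half. This discards a mass of at least `2 ^ (-e - 1)` out of at most `1`, so it
happens at most `2 ^ (e + 1)` times. `X` is only a limit, but fixed bits are never revised, so every
preliminary list is compatible with it.

The atoms `b i` are free over `Γ`, so some world of `Γ` gives them the values `X`, and it is
plausible on every day. In it, each list of sentences obtained from `Ψ` contains a true one. A
trader buys equally many shares of all sentences of the current list, and only while the sum of
their prices is below `1 / (1 + s) ^ 2`, where `s` is the present holding. The total cost is at most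
`2`, while in that world the shares pay at least `s`. Since the trader must not exploit the market,
`s` stays bounded, which gives one `ε > 0` below the sum of prices for all lists from some day on
(`IsLogicalInductor.exists_le_sum_price`). The settled list for `e` is in use on infinitely many
days, so its limiting prices sum to at least `ε`. Domination by `C * M` would give `ε ≤ C * 2 ^ (1 -
e)` for all `e`.

Limits of prices exist because a trader who keeps holding plus price in a short interval profits
from every lasting oscillation (`IsLogicalInductor.exists_tendsto`).

The lists are merely computable, whereas traders have to be polynomial-time.
`Writer.exists_slowdown` closes this gap: a machine advances the computation of the next list by one
step per day and keeps using the current list meanwhile. The argument needs only that every list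
comes up at some time. -/

/-! ### Templates and their binary encoding -/

/-- A letter of a template: a mode in which it is written, and a token, or a hole (`none`), which is
filled with a number in unary. -/
abbrev Letter : Type := Bool × Option Token

/-- The string that a template stands for in a mode, the holes being filled with `i`. -/
def fill (m : Bool) (i : ℕ) (ls : List Letter) : List Token :=
  ls.flatMap fun l => if l.1 = m then (l.2.elim (List.replicate i Token.one) fun t => [t]) else []

theorem fill_nil (m : Bool) (i : ℕ) : fill m i [] = [] := rfl

theorem fill_cons (m : Bool) (i : ℕ) (l : Letter) (ls : List Letter) :
    fill m i (l :: ls) =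
      (if l.1 = m then (l.2.elim (List.replicate i Token.one) fun t => [t]) else []) ++
        fill m i ls := by
  simp [fill]

theorem fill_append (m : Bool) (i : ℕ) (l₁ l₂ : List Letter) :
    fill m i (l₁ ++ l₂) = fill m i l₁ ++ fill m i l₂ := by
  simp [fill]

/-- A numbering of the letters. -/
noncomputable def letterEquiv : Letter ≃ Fin 38 :=
  Fintype.equivFinOfCardEq (by
    have h : Fintype.card Token = 18 := by
      rw [Fintype.card_congr Token.equivFin]; simp
    simp [Fintype.card_prod, h])

/-- A template as a number: in binary, from the least significant digit on, the letter with number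
`j` is written as `j` ones and a zero. -/
noncomputable def encodeTemplate (ls : List Letter) : ℕ :=
  ls.foldr (fun l r => (fun x => 2 * x + 1)^[(letterEquiv l : ℕ)] (2 * r)) 1

theorem encodeTemplate_pos (ls : List Letter) : 0 < encodeTemplate ls := by
  induction ls with
  | nil => simp [encodeTemplate]
  | cons l ls ih =>
    change 0 < (fun x => 2 * x + 1)^[(letterEquiv l : ℕ)] (2 * encodeTemplate ls)
    generalize (letterEquiv l : ℕ) = j
    cases j with
    | zero => simpa using ih
    | succ j => rw [Function.iterate_succ_apply']; omega

theorem primrec_encodeTemplate : Primrec encodeTemplate := by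
  unfold encodeTemplate
  have hl : Primrec fun l : Letter => (letterEquiv l : ℕ) := Primrec.dom_finite _
  refine Primrec.list_foldr (f := fun ls : List Letter => ls) (g := fun _ => 1)
    (h := fun _ p => (fun x => 2 * x + 1)^[(letterEquiv p.1 : ℕ)] (2 * p.2))
    Primrec.id (Primrec.const 1) ?_
  have h1 : Primrec fun q : List Letter × Letter × ℕ => (letterEquiv q.2.1 : ℕ) :=
    hl.comp (Primrec.fst.comp Primrec.snd)
  have h2 : Primrec fun q : List Letter × Letter × ℕ => 2 * q.2.2 :=
    Primrec.nat_mul.comp (Primrec.const 2) (Primrec.snd.comp Primrec.snd)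
  exact Primrec.nat_iterate h1 h2
    (Primrec.succ.comp (Primrec.nat_mul.comp (Primrec.const 2) Primrec.snd))

theorem trNat_two_mul {n : ℕ} (hn : 0 < n) : trNat (2 * n) = Γ'.bit0 :: trNat n := by
  have h : ((2 * n : ℕ) : Num) = (n : Num).bit0 := by
    rw [← Num.bit0_of_bit0, two_mul]; push_cast; rfl
  rw [trNat, trNat, h]
  have hne : (n : Num) ≠ 0 := by
    intro h0
    have := congrArg (fun x : Num => (x : ℕ)) h0
    simp at this
    omega
  cases hN : (n : Num) with
  | zero => exact absurd hN hne
  | pos p => rfl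

theorem trNat_two_mul_add_one (n : ℕ) : trNat (2 * n + 1) = Γ'.bit1 :: trNat n := by
  have h : ((2 * n + 1 : ℕ) : Num) = (n : Num).bit1 := by
    rw [← Num.bit1_of_bit1, two_mul]; push_cast; rfl
  rw [trNat, trNat, h]
  cases hN : (n : Num) with
  | zero => rfl
  | pos p => rfl

theorem trNat_encodeTemplate_nil : trNat (encodeTemplate []) = [Γ'.bit1] := by
  have := trNat_two_mul_add_one 0
  simpa [encodeTemplate] using this

/-- This is the form in which the machine decodes: it counts ones and closes a letter at each zero.
The single one that encodes the empty template remains as the top digit and carries no letter. -/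
theorem trNat_encodeTemplate_cons (l : Letter) (ls : List Letter) :
    trNat (encodeTemplate (l :: ls)) =
      List.replicate (letterEquiv l : ℕ) Γ'.bit1 ++ Γ'.bit0 :: trNat (encodeTemplate ls) := by
  change trNat ((fun x => 2 * x + 1)^[(letterEquiv l : ℕ)] (2 * encodeTemplate ls)) = _
  generalize (letterEquiv l : ℕ) = j
  induction j with
  | zero => simpa using trNat_two_mul (encodeTemplate_pos ls)
  | succ j ih =>
    rw [Function.iterate_succ_apply', trNat_two_mul_add_one, ih, List.replicate_succ]
    rfl

/-- Each letter contributes at least its closing zero. A template decoded from a stack is therefore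
no longer than the stack is high. -/
theorem length_le_trNat_encodeTemplate (ls : List Letter) :
    ls.length ≤ (trNat (encodeTemplate ls)).length := by
  induction ls with
  | nil => simp
  | cons l ls ih => rw [trNat_encodeTemplate_cons]; simp; omega

/-! ### A computation that runs forever -/

/-- The output carries the next argument behind the value: once `F k` has been read off the main
stack, what remains there is already the input of the next round. -/
theorem exists_code_iterating {F : ℕ → ℕ} (hF : Computable F) :
    ∃ c : Code, ∀ k, c.eval [k] = pure [F k, k + 1] := by
  have h := Nat.Partrec'.part_iff₁.2 hF.partrec
  obtain ⟨c, hc⟩ := Code.exists_code h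
  refine ⟨Code.cons c Code.succ, fun k => ?_⟩
  have := hc ⟨[k], rfl⟩
  simp only [Code.cons_eval, Code.succ_eval]
  erw [this]
  simp [List.Vector.head, pure]

/-- The number of `push` instructions on a path through a statement, at most. -/
def pushes {K : Type} {Γ : K → Type} {Λ σ : Type} : TM2.Stmt Γ Λ σ → ℕ
  | .push _ _ q => pushes q + 1
  | .peek _ _ q => pushes q
  | .pop _ _ q => pushes q
  | .load _ q => pushes q
  | .branch _ q₁ q₂ => max (pushes q₁) (pushes q₂)
  | .goto _ => 0
  | .halt => 0

/-- Together with `pushes_tr` this makes the stacks grow at most linearly with the number of steps,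
however fast the computed function grows. -/
theorem length_stepAux_le {K : Type} [DecidableEq K] {Γ : K → Type} {Λ σ : Type}
    (q : TM2.Stmt Γ Λ σ) (v : σ) (S : ∀ k, List (Γ k)) (k : K) :
    ((TM2.stepAux q v S).stk k).length ≤ (S k).length + pushes q := by
  induction q generalizing v S with
  | push k' f q ih =>
    refine (ih _ _).trans ?_
    by_cases h : k = k'
    · subst h; simp [pushes]; omega
    · simp only [pushes, Function.update_of_ne h]; omega
  | pop k' f q ih =>
    refine (ih _ _).trans ?_
    by_cases h : k = k'
    · subst h; simp [pushes]
    · simp [pushes, Function.update_of_ne h]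
  | peek k' f q ih => exact ih _ _
  | load f q ih => exact ih _ _
  | branch f q₁ q₂ ih₁ ih₂ =>
    simp only [TM2.stepAux, pushes]
    cases f v
    · exact (ih₂ _ _).trans (by omega)
    · exact (ih₁ _ _).trans (by omega)
  | goto f => simp [pushes]
  | halt => simp [pushes]

theorem pushes_tr (l : Λ') : pushes (tr l) ≤ 2 := by
  cases l with
  | ret k => cases k <;> simp [tr, pushes]
  | _ => simp [tr, pushes]

/-- A state of the iterated computation: the number of completed rounds, the label, the local
variable and the stacks. -/
structure Inner where
  round : ℕ
  lab : Λ'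
  var : Option Γ'
  stk : K' → List Γ'

/-- The state at the start of a round. -/
def Inner.start (c : Code) (k : ℕ) : Inner :=
  ⟨k, trNormal c Cont'.halt, none, K'.elim (trList [k]) [] [] []⟩

/-- A step of the iterated computation; when a round halts, the next one starts. -/
def Inner.next (c : Code) (s : Inner) : Inner :=
  match TM2.stepAux (tr s.lab) s.var s.stk with
  | ⟨some l, v, S⟩ => ⟨s.round, l, v, S⟩
  | ⟨none, _, _⟩ => Inner.start c (s.round + 1)

/-- The state of the iterated computation after `i` steps. -/
def Inner.after (c : Code) (i : ℕ) : Inner := (Inner.next c)^[i] (Inner.start c 0)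

theorem Inner.after_zero (c : Code) : Inner.after c 0 = Inner.start c 0 := rfl

theorem Inner.after_succ (c : Code) (i : ℕ) :
    Inner.after c (i + 1) = Inner.next c (Inner.after c i) :=
  Function.iterate_succ_apply' _ _ _

/-- The configuration of the running round. -/
def Inner.cfg (s : Inner) : Cfg' := ⟨some s.lab, s.var, s.stk⟩

/-- The state is reached within its round. -/
def Inner.Valid (c : Code) (s : Inner) : Prop :=
  StateTransition.Reaches (TM2.step tr) (init c [s.round]) s.cfg

theorem Inner.valid_start (c : Code) (k : ℕ) : (Inner.start c k).Valid c :=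
  Relation.ReflTransGen.refl

theorem Inner.Valid.next {c : Code} {s : Inner} (h : s.Valid c) : (s.next c).Valid c := by
  unfold Inner.next
  split
  next l v S heq =>
    refine Relation.ReflTransGen.tail h ?_
    simp [Inner.cfg, TM2.step, heq]
  next => exact Inner.valid_start _ _

theorem Inner.valid_after (c : Code) (i : ℕ) : (Inner.after c i).Valid c := by
  induction i with
  | zero => exact Inner.valid_start c 0
  | succ i ih => rw [Inner.after_succ]; exact ih.next

/-- `Λ'` is infinite, but a fixed code reaches only a finite set of labels. This is what allows the
label to be kept in the finite internal state of the machine. -/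
theorem Inner.Valid.lab_mem {c : Code} {s : Inner} (h : s.Valid c) :
    s.lab ∈ codeSupp c Cont'.halt := by
  let _ : Inhabited Λ' := ⟨trNormal c Cont'.halt⟩
  have hs := tr_supports c Cont'.halt
  have key : ∀ b : Cfg', StateTransition.Reaches (TM2.step tr) (init c [s.round]) b →
      TM2.Cfg.l b ∈ Finset.insertNone (codeSupp c Cont'.halt) := by
    intro b hb
    induction hb with
    | refl => exact Finset.some_mem_insertNone.2 hs.1
    | tail _ hbc ih => exact TM2.step_supports tr hs hbc ih
  exact Finset.some_mem_insertNone.1 (key _ h)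

/-- Evaluation is single-valued, so a halting configuration reached within the round is the one
described by `tr_eval`. -/
theorem Inner.Valid.halted {c : Code} {F : ℕ → ℕ} (hc : ∀ k, c.eval [k] = pure [F k, k + 1])
    {s : Inner} (h : s.Valid c) (hl : (TM2.stepAux (tr s.lab) s.var s.stk).l = none) :
    (TM2.stepAux (tr s.lab) s.var s.stk).stk =
      K'.elim (trList [F s.round, s.round + 1]) [] [] [] := by
  have hev := tr_eval c [s.round]
  rw [hc] at hev
  have hmem : (TM2.stepAux (tr s.lab) s.var s.stk : Cfg') ∈
      StateTransition.eval (TM2.step tr) (init c [s.round]) := by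
    refine StateTransition.mem_eval.2 ⟨Relation.ReflTransGen.tail h rfl, ?_⟩
    generalize TM2.stepAux (tr s.lab) s.var s.stk = b at hl
    obtain ⟨_, _, _⟩ := b
    subst hl
    rfl
  rw [hev] at hmem
  have : TM2.stepAux (tr s.lab) s.var s.stk = halt [F s.round, s.round + 1] := by
    simp only [Part.map_eq_map, pure, Part.map_some] at hmem
    exact Part.mem_some_iff.1 hmem
  rw [this]
  rfl

/-- A step adds at most two symbols to a stack. A restart adds none beyond that, because the new
main stack is the end of what the halted round has left there. -/
theorem Inner.length_after_le {c : Code} {F : ℕ → ℕ}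
    (hc : ∀ k, c.eval [k] = pure [F k, k + 1]) (i : ℕ) (k : K') :
    ((Inner.after c i).stk k).length ≤ 2 * i + 1 := by
  induction i generalizing k with
  | zero => cases k <;> simp [Inner.after_zero, Inner.start]
  | succ i ih =>
    rw [Inner.after_succ]
    set s := Inner.after c i with hs
    have hlen := fun k => length_stepAux_le (tr s.lab) s.var s.stk k
    have hp := pushes_tr s.lab
    unfold Inner.next
    split
    next l v S heq =>
      have := hlen k
      rw [heq] at this
      have := ih k
      simp only at *
      omega
    next v S heq =>
      have hh := (Inner.valid_after c i).halted hc (by rw [← hs, heq])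
      have hm := hlen K'.main
      have := ih K'.main
      rw [← hs] at hh
      rw [hh] at hm
      cases k <;> simp [Inner.start] at hm ⊢
      omega

/-- The rounds of the iterated computation all come up. -/
theorem Inner.round_surjective {c : Code} {F : ℕ → ℕ}
    (hc : ∀ k, c.eval [k] = pure [F k, k + 1]) (k : ℕ) :
    ∃ i, Inner.after c i = Inner.start c k := by
  induction k with
  | zero => exact ⟨0, rfl⟩
  | succ k ih =>
    obtain ⟨i, hi⟩ := ih
    have hev := tr_eval c [k]
    rw [hc] at hev
    have hmem : halt [F k, k + 1] ∈ StateTransition.eval (TM2.step tr) (init c [k]) := by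
      rw [hev]
      simp only [Part.map_eq_map, pure, Part.map_some]
      exact Part.mem_some_iff.2 rfl
    obtain ⟨hr, -⟩ := StateTransition.mem_eval.1 hmem
    -- Induction along the halting run of round `k`, with the iterated computation in lockstep; the
    -- step at which the run halts is the one that restarts.
    have key : ∀ a : Cfg', StateTransition.Reaches (TM2.step tr) a (halt [F k, k + 1]) →
        ∀ (s : Inner) (j : ℕ), Inner.after c j = s → s.round = k → s.cfg = a →
          ∃ i, Inner.after c i = Inner.start c (k + 1) := by
      intro a ha
      induction ha using Relation.ReflTransGen.head_induction_on with
      | refl =>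
        intro s j _ _ hs
        exact absurd (congrArg TM2.Cfg.l hs) (by exact Option.some_ne_none _)
      | head hab hbc IH =>
        intro s j hj hk hs
        subst hs
        rename_i b
        have hb : TM2.stepAux (tr s.lab) s.var s.stk = b :=
          Option.some.inj hab
        have hn : Inner.after c (j + 1) = s.next c := by rw [Inner.after_succ, hj]
        unfold Inner.next at hn
        rw [hb] at hn
        obtain ⟨_ | l, v, S⟩ := b
        · exact ⟨j + 1, by rw [hn, hk]⟩
        · exact IH _ _ hn hk rfl
    exact key _ hr _ i hi rfl rfl

/-! ### The machine that writes the strategies -/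

namespace Writer

/-- The stacks: input, output, the reversed output, the current template and the part of it that
has been read, a counter for the day and the part of it that has been read, and the stacks of the
iterated computation. -/
inductive Stack where
  | inp | out | acc | tpl | read | cnt | tmp
  | inn (k : K')
  deriving DecidableEq

instance : Fintype K' := ⟨{K'.main, K'.rev, K'.aux, K'.stack}, fun k => by cases k <;> simp⟩

instance : Fintype Stack :=
  ⟨{.inp, .out, .acc, .tpl, .read, .cnt, .tmp} ∪ Finset.univ.image Stack.inn, fun k => by
    cases k <;> simp⟩

/-- The alphabets of the stacks. -/
abbrev Alphabet : Stack → Type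
  | .inp => Bool
  | .out => Token
  | .acc => Token
  | .tpl => Letter
  | .read => Letter
  | .cnt => Unit
  | .tmp => Unit
  | .inn _ => Γ'

/-- The labels of the iterated computation. -/
abbrev Lab (c : Code) : Type := {l : Λ' // l ∈ codeSupp c Cont'.halt}

/-- The first label of a round of the iterated computation. -/
def firstLab (c : Code) : Lab c :=
  ⟨trNormal c Cont'.halt, codeSupp_self _ _ (trStmts₁_self _)⟩

/-- The internal state: the local variable and the label of the iterated computation, the mode of
writing, the last letter that was read, whether a letter was found, and the number of the letter
that is being decoded. -/
structure State (c : Code) where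
  var : Option Γ'
  lab : Lab c
  mode : Bool
  ltr : Option Letter
  ok : Bool
  num : Fin 38

/-- The internal states as tuples. -/
def State.equiv (c : Code) :
    State c ≃ Option Γ' × Lab c × Bool × Option Letter × Bool × Fin 38 where
  toFun s := (s.var, s.lab, s.mode, s.ltr, s.ok, s.num)
  invFun t := ⟨t.1, t.2.1, t.2.2.1, t.2.2.2.1, t.2.2.2.2.1, t.2.2.2.2.2⟩
  left_inv _ := rfl
  right_inv _ := rfl

instance (c : Code) : Fintype (State c) := Fintype.ofEquiv _ (State.equiv c).symm

/-- The initial state. -/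
def State.init (c : Code) : State c := ⟨none, firstLab c, false, none, false, 0⟩

/-- The labels of the routines of the machine. -/
inductive Routine where
  | start | day | write | copy | uncopy | restore | clear | load | wipe | flush
  deriving DecidableEq

instance : Fintype Routine :=
  ⟨{.start, .day, .write, .copy, .uncopy, .restore, .clear, .load, .wipe, .flush}, fun k => by
    cases k <;> simp⟩

/-- The labels of the machine. -/
abbrev Label (c : Code) : Type := Routine ⊕ Lab c

/-- The statements of the machine. -/
abbrev Stm (c : Code) : Type := TM2.Stmt Alphabet (Label c) (State c)

open TM2.Stmt

/-- Push the letters of a list, one after the other. -/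
def pushAll {c : Code} (k : Stack) (xs : List (Alphabet k)) (q : Stm c) : Stm c :=
  xs.foldr (fun x q => push k (fun _ => x) q) q

open Classical in
/-- A label of the iterated computation, if it is one. -/
noncomputable def toLab (c : Code) (l : Λ') : Lab c :=
  if h : l ∈ codeSupp c Cont'.halt then ⟨l, h⟩ else firstLab c

/-- A statement of the iterated computation as a statement of the machine, which afterwards turns to
the next day or, if the round has come to its end, to reading the result. -/
noncomputable def lift (c : Code) : TM2.Stmt (fun _ : K' => Γ') Λ' (Option Γ') → Stm c
  | .push k f q => push (.inn k) (fun s => f s.var) (lift c q)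
  | .peek k f q => peek (.inn k) (fun s o => { s with var := f s.var o }) (lift c q)
  | .pop k f q => pop (.inn k) (fun s o => { s with var := f s.var o }) (lift c q)
  | .load f q => load (fun s => { s with var := f s.var }) (lift c q)
  | .branch f q₁ q₂ => branch (fun s => f s.var) (lift c q₁) (lift c q₂)
  | .goto f => load (fun s => { s with lab := toLab c (f s.var) }) (goto fun _ => .inl .day)
  | .halt => goto fun _ => .inl .clear

/-- The program of the machine. -/
noncomputable def program (c : Code) (lit : List Token) (tpl : List Letter) : Label c → Stm c
  | .inl .start =>
    -- A lone separator is `trList [0]`, the input of round `0`, since `0` has no binary digits.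
    pushAll .acc lit (pushAll .tpl tpl.reverse (push (.inn .main) (fun _ => Γ'.cons)
      (goto fun _ => .inl .day)))
  | .inl .day =>
    -- Each day consumes one letter of the unary input. When none is left, the last day has come, on
    -- which orders are written instead of a definition.
    pop .inp (fun s o => { s with mode := o.isNone }) (goto fun _ => .inl .write)
  | .inl .write =>
    pop .tpl (fun s o => { s with ltr := o, ok := false }) <|
      branch (fun s => s.ltr.isNone) (goto fun _ => .inl .restore) <|
        push .read (fun s => s.ltr.getD default) <|
          branch (fun s => decide ((s.ltr.getD default).1 = s.mode))
            (branch (fun s => (s.ltr.getD default).2.isSome)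
              (push .acc (fun s => (s.ltr.getD default).2.getD .zero) (goto fun _ => .inl .write))
              (goto fun _ => .inl .copy))
            (goto fun _ => .inl .write)
  | .inl .copy =>
    pop .cnt (fun s o => { s with ok := o.isSome }) <|
      branch (fun s => s.ok)
        (push .tmp (fun _ => ()) (push .acc (fun _ => Token.one) (goto fun _ => .inl .copy)))
        (goto fun _ => .inl .uncopy)
  | .inl .uncopy =>
    pop .tmp (fun s o => { s with ok := o.isSome }) <|
      branch (fun s => s.ok) (push .cnt (fun _ => ()) (goto fun _ => .inl .uncopy))
        (goto fun _ => .inl .write)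
  | .inl .restore =>
    pop .read (fun s o => { s with ltr := o }) <|
      branch (fun s => s.ltr.isSome)
        (push .tpl (fun s => s.ltr.getD default) (goto fun _ => .inl .restore)) <|
        branch (fun s => s.mode) (goto fun _ => .inl .wipe)
          (push .cnt (fun _ => ()) (goto fun s => .inr s.lab))
  | .inr l => lift c (tr l.1)
  | .inl .clear =>
    pop .tpl (fun s o => { s with ltr := o }) <|
      branch (fun s => s.ltr.isSome) (goto fun _ => .inl .clear) (goto fun _ => .inl .load)
  | .inl .load =>
    pop (.inn .main) (fun s o => { s with var := o }) <|
      branch (fun s => decide (s.var = some Γ'.bit1))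
        (load (fun s => { s with num := s.num + 1 }) (goto fun _ => .inl .load)) <|
        branch (fun s => decide (s.var = some Γ'.bit0))
          (push .tpl (fun s => letterEquiv.symm s.num)
            (load (fun s => { s with num := 0 }) (goto fun _ => .inl .load)))
          -- The separator has been reached. The top digit was counted but not closed by a zero, so
          -- the count is dropped.
          (load (fun s => { s with num := 0, var := none, lab := firstLab c })
            (goto fun _ => .inl .day))
  | .inl .wipe =>
    -- A computation in Mathlib's sense has to halt with all stacks but the output empty and in the
    -- initial internal state, so everything is cleared.
    load (fun s => { s with ok := false }) <|
    pop .tpl (fun s o => { s with ok := s.ok || o.isSome }) <|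
    pop .cnt (fun s o => { s with ok := s.ok || o.isSome }) <|
    pop (.inn .main) (fun s o => { s with ok := s.ok || o.isSome }) <|
    pop (.inn .rev) (fun s o => { s with ok := s.ok || o.isSome }) <|
    pop (.inn .aux) (fun s o => { s with ok := s.ok || o.isSome }) <|
    pop (.inn .stack) (fun s o => { s with ok := s.ok || o.isSome }) <|
      branch (fun s => s.ok) (goto fun _ => .inl .wipe) (goto fun _ => .inl .flush)
  | .inl .flush =>
    pop .acc (fun s o => { s with ltr := o.map fun t => (false, some t) }) <|
      branch (fun s => s.ltr.isSome)
        (push .out (fun s => (s.ltr.getD default).2.getD .zero) (goto fun _ => .inl .flush))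
        (load (fun _ => State.init c) halt)

/-- The machine. -/
noncomputable def machine (c : Code) (lit : List Token) (tpl : List Letter) : FinTM2 where
  K := Stack
  k₀ := .inp
  k₁ := .out
  Γ := Alphabet
  Λ := Label c
  main := .inl .start
  σ := State c
  initialState := State.init c
  Γk₀Fin := inferInstanceAs (Fintype Bool)
  m := program c lit tpl

/-! ### Runs -/

/-- The contents of the stacks. -/
structure Contents where
  inp : List Bool
  out : List Token
  acc : List Token
  tpl : List Letter
  read : List Letter
  cnt : List Unit
  tmp : List Unit
  inn : K' → List Γ'

/-- The contents of the stacks as a function. -/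
def Contents.fn (S : Contents) : ∀ k, List (Alphabet k)
  | .inp => S.inp
  | .out => S.out
  | .acc => S.acc
  | .tpl => S.tpl
  | .read => S.read
  | .cnt => S.cnt
  | .tmp => S.tmp
  | .inn k => S.inn k

section
variable (S : Contents)

@[simp] theorem fn_inp : S.fn .inp = S.inp := rfl
@[simp] theorem fn_out : S.fn .out = S.out := rfl
@[simp] theorem fn_acc : S.fn .acc = S.acc := rfl
@[simp] theorem fn_tpl : S.fn .tpl = S.tpl := rfl
@[simp] theorem fn_read : S.fn .read = S.read := rfl
@[simp] theorem fn_cnt : S.fn .cnt = S.cnt := rfl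
@[simp] theorem fn_tmp : S.fn .tmp = S.tmp := rfl
@[simp] theorem fn_inn (k : K') : S.fn (.inn k) = S.inn k := rfl

open Function (update)

@[simp] theorem update_inp (x : List Bool) :
    update S.fn .inp x = Contents.fn { S with inp := x } := by
  funext k; cases k <;> rfl
@[simp] theorem update_out (x : List Token) :
    update S.fn .out x = Contents.fn { S with out := x } := by
  funext k; cases k <;> rfl
@[simp] theorem update_acc (x : List Token) :
    update S.fn .acc x = Contents.fn { S with acc := x } := by
  funext k; cases k <;> rfl
@[simp] theorem update_tpl (x : List Letter) :
    update S.fn .tpl x = Contents.fn { S with tpl := x } := by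
  funext k; cases k <;> rfl
@[simp] theorem update_read (x : List Letter) :
    update S.fn .read x = Contents.fn { S with read := x } := by
  funext k; cases k <;> rfl
@[simp] theorem update_cnt (x : List Unit) :
    update S.fn .cnt x = Contents.fn { S with cnt := x } := by
  funext k; cases k <;> rfl
@[simp] theorem update_tmp (x : List Unit) :
    update S.fn .tmp x = Contents.fn { S with tmp := x } := by
  funext k; cases k <;> rfl
@[simp] theorem update_inn (k : K') (x : List Γ') :
    update S.fn (.inn k) x = Contents.fn { S with inn := update S.inn k x } := by
  funext j
  cases j with
  | inn j =>
    by_cases h : j = k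
    · subst h; simp
    · have h' : Stack.inn j ≠ Stack.inn k := fun e => h (Stack.inn.inj e)
      simp [Function.update_of_ne h, Function.update_of_ne h']
  | _ => rfl

end

/-- The configurations of the machine. -/
abbrev Conf (c : Code) : Type := TM2.Cfg Alphabet (Label c) (State c)

/-- The machine comes from a configuration to another one in at most `t` steps. -/
def Runs (c : Code) (lit : List Token) (tpl : List Letter) (t : ℕ) (a b : Conf c) : Prop :=
  ∃ s ≤ t, (flip bind (TM2.step (program c lit tpl)))^[s] (some a) = some b

section
variable {c : Code} {lit : List Token} {tpl : List Letter}

theorem Runs.refl (a : Conf c) : Runs c lit tpl 0 a a := ⟨0, le_rfl, rfl⟩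

theorem Runs.trans {t₁ t₂ : ℕ} {a b d : Conf c} (h₁ : Runs c lit tpl t₁ a b)
    (h₂ : Runs c lit tpl t₂ b d) : Runs c lit tpl (t₁ + t₂) a d := by
  obtain ⟨s₁, hs₁, e₁⟩ := h₁
  obtain ⟨s₂, hs₂, e₂⟩ := h₂
  refine ⟨s₂ + s₁, by omega, ?_⟩
  rw [Function.iterate_add_apply, e₁, e₂]

theorem Runs.mono {t₁ t₂ : ℕ} {a b : Conf c} (h : Runs c lit tpl t₁ a b) (ht : t₁ ≤ t₂) :
    Runs c lit tpl t₂ a b := by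
  obtain ⟨s, hs, e⟩ := h
  exact ⟨s, hs.trans ht, e⟩

theorem Runs.single {a b : Conf c} (h : TM2.step (program c lit tpl) a = some b) :
    Runs c lit tpl 1 a b := ⟨1, le_rfl, h⟩

theorem Runs.head {t : ℕ} {a b d : Conf c} (h : TM2.step (program c lit tpl) a = some b)
    (h₂ : Runs c lit tpl t b d) : Runs c lit tpl (t + 1) a d :=
  ((Runs.single h).trans h₂).mono (by omega)

theorem stepAux_pushAll_acc (xs : List Token) (q : Stm c) (s : State c) (S : Contents) :
    TM2.stepAux (pushAll .acc xs q) s S.fn =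
      TM2.stepAux q s (Contents.fn { S with acc := xs.reverse ++ S.acc }) := by
  induction xs generalizing S with
  | nil => rfl
  | cons x xs ih =>
    change TM2.stepAux (push .acc (fun _ => x) (pushAll .acc xs q)) s S.fn = _
    rw [TM2.stepAux, update_acc, ih]
    simp

theorem stepAux_pushAll_tpl (xs : List Letter) (q : Stm c) (s : State c) (S : Contents) :
    TM2.stepAux (pushAll .tpl xs q) s S.fn =
      TM2.stepAux q s (Contents.fn { S with tpl := xs.reverse ++ S.tpl }) := by
  induction xs generalizing S with
  | nil => rfl
  | cons x xs ih =>
    change TM2.stepAux (push .tpl (fun _ => x) (pushAll .tpl xs q)) s S.fn = _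
    rw [TM2.stepAux, update_tpl, ih]
    simp

theorem runs_start (s : State c) (x : List Bool) :
    Runs c lit tpl 1 ⟨some (.inl .start), s, Contents.fn ⟨x, [], [], [], [], [], [], fun _ => []⟩⟩
      ⟨some (.inl .day), s, Contents.fn ⟨x, [], lit.reverse, tpl, [], [], [],
        K'.elim (trList [0]) [] [] []⟩⟩ := by
  refine Runs.single ?_
  simp only [TM2.step, program, stepAux_pushAll_acc, stepAux_pushAll_tpl, TM2.stepAux, update_inn,
    fn_inn]
  congr 3
  simp only [List.append_nil, List.reverse_reverse, Contents.mk.injEq, true_and]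
  funext k
  cases k <;> simp

theorem runs_copy (i : ℕ) (s : State c) (S : Contents) (hS : S.cnt = List.replicate i ()) :
    Runs c lit tpl (i + 1) ⟨some (.inl .copy), s, S.fn⟩
      ⟨some (.inl .uncopy), { s with ok := false }, Contents.fn { S with
        acc := List.replicate i Token.one ++ S.acc, cnt := [],
        tmp := List.replicate i () ++ S.tmp }⟩ := by
  induction i generalizing s S with
  | zero => exact Runs.single (by simp [program, hS])
  | succ i ih =>
    refine Runs.head (b := ⟨some (.inl .copy), { s with ok := true }, Contents.fn { S with
      cnt := List.replicate i (), tmp := () :: S.tmp, acc := Token.one :: S.acc }⟩) ?_ ?_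
    · simp [program, hS, List.replicate_succ]
    · rw [List.replicate_succ', List.replicate_succ', List.append_assoc, List.append_assoc]
      exact ih _ _ rfl

theorem runs_uncopy (i : ℕ) (s : State c) (S : Contents) (hS : S.tmp = List.replicate i ()) :
    Runs c lit tpl (i + 1) ⟨some (.inl .uncopy), s, S.fn⟩
      ⟨some (.inl .write), { s with ok := false }, Contents.fn { S with
        cnt := List.replicate i () ++ S.cnt, tmp := [] }⟩ := by
  induction i generalizing s S with
  | zero => exact Runs.single (by simp [program, hS])
  | succ i ih =>
    refine Runs.head (b := ⟨some (.inl .uncopy), { s with ok := true }, Contents.fn { S with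
      tmp := List.replicate i (), cnt := () :: S.cnt }⟩) ?_ ?_
    · simp [program, hS, List.replicate_succ]
    · rw [List.replicate_succ', List.append_assoc]
      exact ih _ _ rfl

/-- The dearest letter is a hole: one step to read it, `i + 1` steps to copy the day counter to the
output, and `i + 1` steps to put the counter back. -/
theorem runs_write (i : ℕ) (ls : List Letter) (s : State c) (S : Contents) (hS : S.tpl = ls)
    (hc : S.cnt = List.replicate i ()) (ht : S.tmp = []) :
    Runs c lit tpl (ls.length * (2 * i + 3) + 1) ⟨some (.inl .write), s, S.fn⟩
      ⟨some (.inl .restore), { s with ltr := none, ok := false }, Contents.fn { S with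
        acc := (fill s.mode i ls).reverse ++ S.acc, tpl := [],
        read := ls.reverse ++ S.read }⟩ := by
  induction ls generalizing s S with
  | nil => exact (Runs.single (by simp [program, hS, fill_nil])).mono (by omega)
  | cons l ls ih =>
    obtain ⟨m, o⟩ := l
    have harith : (((m, o) :: ls : List Letter).length * (2 * i + 3) + 1) =
        (i + 1 + ((i + 1) + (ls.length * (2 * i + 3) + 1))) + 1 := by
      simp only [List.length_cons]; ring
    rw [harith, fill_cons, List.reverse_cons, List.reverse_append, List.append_assoc,
      List.append_assoc]
    by_cases hm : m = s.mode
    · cases o with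
      | some t =>
        have h := Runs.head (lit := lit) (tpl := tpl) (a := ⟨some (.inl .write), s, S.fn⟩)
          (by simp [program, hS, hm]) (ih { s with ltr := some (m, some t), ok := false }
            { S with tpl := ls, read := (m, some t) :: S.read, acc := t :: S.acc } rfl hc ht)
        convert h.mono (t₂ := i + 1 + ((i + 1) + (ls.length * (2 * i + 3) + 1)) + 1) (by omega)
          using 4
        · simp [hm]
        · rfl
      | none =>
        have h1 := runs_copy (lit := lit) (tpl := tpl) i
          { s with ltr := some (m, none), ok := false }
          { S with tpl := ls, read := (m, none) :: S.read } hc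
        have h2 := runs_uncopy (lit := lit) (tpl := tpl) i
          { s with ltr := some (m, none), ok := false } _
          (show (Contents.tmp { S with
            tpl := ls, read := (m, none) :: S.read, acc := List.replicate i Token.one ++ S.acc,
            cnt := [], tmp := List.replicate i () ++ S.tmp }) = List.replicate i () by simp [ht])
        have h3 := h1.trans (h2.trans (ih _ _ rfl (by simp) rfl))
        have h := Runs.head (a := ⟨some (.inl .write), s, S.fn⟩)
          (by simp [program, hS, hm]) h3
        convert h using 4
        · simp [hm]
        · rfl
        · simp [hc]
    · have h := Runs.head (lit := lit) (tpl := tpl) (a := ⟨some (.inl .write), s, S.fn⟩)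
        (by simp [program, hS, hm]) (ih { s with ltr := some (m, o), ok := false }
          { S with tpl := ls, read := (m, o) :: S.read } rfl hc ht)
      convert h.mono (t₂ := i + 1 + ((i + 1) + (ls.length * (2 * i + 3) + 1)) + 1) (by omega)
        using 4
      · simp [hm]
      · rfl

theorem runs_restore_definitions (ls : List Letter) (s : State c) (S : Contents)
    (hS : S.read = ls) (hm : s.mode = false) :
    Runs c lit tpl (ls.length + 1) ⟨some (.inl .restore), s, S.fn⟩
      ⟨some (.inr s.lab), { s with ltr := none }, Contents.fn { S with
        tpl := ls.reverse ++ S.tpl, read := [], cnt := () :: S.cnt }⟩ := by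
  induction ls generalizing s S with
  | nil => exact Runs.single (by simp [program, hS, hm])
  | cons l ls ih =>
    refine Runs.head (b := ⟨some (.inl .restore), { s with ltr := some l }, Contents.fn { S with
      tpl := l :: S.tpl, read := ls }⟩) ?_ ?_
    · simp [program, hS]
    · rw [List.reverse_cons, List.append_assoc]
      exact ih _ _ rfl hm

theorem runs_restore_orders (ls : List Letter) (s : State c) (S : Contents)
    (hS : S.read = ls) (hm : s.mode = true) :
    Runs c lit tpl (ls.length + 1) ⟨some (.inl .restore), s, S.fn⟩
      ⟨some (.inl .wipe), { s with ltr := none }, Contents.fn { S with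
        tpl := ls.reverse ++ S.tpl, read := [] }⟩ := by
  induction ls generalizing s S with
  | nil => exact Runs.single (by simp [program, hS, hm])
  | cons l ls ih =>
    refine Runs.head (b := ⟨some (.inl .restore), { s with ltr := some l }, Contents.fn { S with
      tpl := l :: S.tpl, read := ls }⟩) ?_ ?_
    · simp [program, hS]
    · rw [List.reverse_cons, List.append_assoc]
      exact ih _ _ rfl hm

/-- A statement is executed up to its `goto` or `halt` in a single machine step, so a day simulates
exactly one step of the iterated computation. -/
theorem stepAux_lift (q : TM2.Stmt (fun _ : K' => Γ') Λ' (Option Γ')) (s : State c)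
    (S : Contents) :
    TM2.stepAux (lift c q) s S.fn =
      match TM2.stepAux q s.var S.inn with
      | ⟨some l, v, T⟩ => ⟨some (.inl .day), { s with var := v, lab := toLab c l },
          Contents.fn { S with inn := T }⟩
      | ⟨none, v, T⟩ => ⟨some (.inl .clear), { s with var := v },
          Contents.fn { S with inn := T }⟩ := by
  induction q generalizing s S with
  | push k f q ih => simp only [lift, TM2.stepAux, update_inn, ih, fn_inn]
  | peek k f q ih => simp only [lift, TM2.stepAux, ih, fn_inn]
  | pop k f q ih => simp only [lift, TM2.stepAux, update_inn, ih, fn_inn]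
  | load f q ih => simp only [lift, TM2.stepAux, ih]
  | branch f q₁ q₂ ih₁ ih₂ =>
    simp only [lift, TM2.stepAux]
    cases f s.var
    · exact ih₂ s S
    · exact ih₁ s S
  | goto f => rfl
  | halt => rfl

theorem runs_clear (ls : List Letter) (s : State c) (S : Contents) (hS : S.tpl = ls) :
    Runs c lit tpl (ls.length + 1) ⟨some (.inl .clear), s, S.fn⟩
      ⟨some (.inl .load), { s with ltr := none }, Contents.fn { S with tpl := [] }⟩ := by
  induction ls generalizing s S with
  | nil => exact Runs.single (by simp [program, hS])
  | cons l ls ih =>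
    refine Runs.head (b := ⟨some (.inl .clear), { s with ltr := some l }, Contents.fn { S with
      tpl := ls }⟩) ?_ (ih _ _ rfl)
    simp [program, hS]

theorem add_one_add_ofNat (a : Fin 38) (j : ℕ) :
    a + 1 + Fin.ofNat 38 j = a + Fin.ofNat 38 (j + 1) := by
  apply Fin.ext
  have h1 : ((1 : Fin 38) : ℕ) = 1 := rfl
  simp only [Fin.val_add, Fin.ofNat, h1]
  omega

theorem runs_load_bits (j : ℕ) (r : List Γ') (s : State c) (S : Contents)
    (hS : S.inn .main = List.replicate j Γ'.bit1 ++ r) :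
    ∃ v, Runs c lit tpl j ⟨some (.inl .load), s, S.fn⟩
      ⟨some (.inl .load), { s with num := s.num + Fin.ofNat 38 j, var := v },
        Contents.fn { S with inn := Function.update S.inn .main r }⟩ := by
  induction j generalizing s S with
  | zero =>
    refine ⟨s.var, ?_⟩
    have : Function.update S.inn .main r = S.inn := by
      rw [← show S.inn .main = r by simpa using hS, Function.update_eq_self]
    simpa [this] using Runs.refl (lit := lit) (tpl := tpl) _
  | succ j ih =>
    obtain ⟨v, hv⟩ := ih { s with num := s.num + 1, var := some Γ'.bit1 }
      { S with inn := Function.update S.inn .main (List.replicate j Γ'.bit1 ++ r) } (by simp)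
    have h := Runs.head (lit := lit) (tpl := tpl) (a := ⟨some (.inl .load), s, S.fn⟩)
      (by simp [program, hS, List.replicate_succ]) hv
    refine ⟨v, ?_⟩
    rw [← add_one_add_ofNat]
    simp only [Function.update_idem] at h
    exact h

/-- Letters are pushed in the order of decoding, so the template arrives reversed. This is why the
computed numbers encode reversed templates. -/
theorem runs_load (ls : List Letter) (r : List Γ') (s : State c) (S : Contents)
    (hs : s.num = 0)
    (hS : S.inn .main = trNat (encodeTemplate ls) ++ Γ'.cons :: r) :
    Runs c lit tpl ((trNat (encodeTemplate ls)).length + 1) ⟨some (.inl .load), s, S.fn⟩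
      ⟨some (.inl .day), { s with num := 0, var := none, lab := firstLab c },
        Contents.fn { S with
          tpl := ls.reverse ++ S.tpl, inn := Function.update S.inn .main r }⟩ := by
  induction ls generalizing s S with
  | nil =>
    rw [trNat_encodeTemplate_nil] at hS ⊢
    refine Runs.head (b := ⟨some (.inl .load), { s with num := 1, var := some Γ'.bit1 },
      Contents.fn { S with inn := Function.update S.inn .main (Γ'.cons :: r) }⟩) ?_ ?_
    · simp [program, hS, hs]
    · refine Runs.single ?_
      simp [program]
  | cons l ls ih =>
    rw [trNat_encodeTemplate_cons] at hS ⊢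
    rw [List.append_assoc] at hS
    obtain ⟨v, hv⟩ := runs_load_bits (lit := lit) (tpl := tpl) _ _ s S hS
    have h2 := ih { s with num := 0, var := some Γ'.bit0 }
      { S with
        tpl := l :: S.tpl,
        inn := Function.update S.inn .main (trNat (encodeTemplate ls) ++ Γ'.cons :: r) } rfl
      (by simp)
    have h := hv.trans (Runs.head (by simp [program, hs]) h2)
    rw [List.reverse_cons, List.append_assoc, List.length_append, List.length_replicate,
      List.length_cons]
    simp only [Function.update_idem] at h
    exact h.mono (by omega)

theorem step_wipe (s : State c) (S : Contents) (ok : Bool)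
    (hok : ok = (S.tpl.head?.isSome || S.cnt.head?.isSome || (S.inn .main).head?.isSome ||
      (S.inn .rev).head?.isSome || (S.inn .aux).head?.isSome || (S.inn .stack).head?.isSome)) :
    TM2.step (program c lit tpl) ⟨some (.inl .wipe), s, S.fn⟩ =
      some ⟨some (.inl (bif ok then .wipe else .flush)), { s with ok := ok }, Contents.fn { S with
        tpl := S.tpl.tail, cnt := S.cnt.tail, inn := fun k => (S.inn k).tail }⟩ := by
  have hinn : ∀ T : K' → List Γ', Function.update (Function.update (Function.update
      (Function.update T .main (T .main).tail) .rev (T .rev).tail) .aux (T .aux).tail) .stack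
        (T .stack).tail = fun k => (T k).tail := by
    intro T; funext k; cases k <;> simp
  simp only [program, TM2.step, TM2.stepAux, update_tpl, update_cnt, update_inn, fn_tpl, fn_cnt,
    fn_inn, Function.update_of_ne (show K'.rev ≠ K'.main by decide),
    Function.update_of_ne (show K'.aux ≠ K'.main by decide),
    Function.update_of_ne (show K'.aux ≠ K'.rev by decide),
    Function.update_of_ne (show K'.stack ≠ K'.main by decide),
    Function.update_of_ne (show K'.stack ≠ K'.rev by decide),
    Function.update_of_ne (show K'.stack ≠ K'.aux by decide), hinn, Bool.false_or, ← hok]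
  cases ok <;> rfl

theorem runs_wipe (n : ℕ) (s : State c) (S : Contents) (h1 : S.tpl.length ≤ n)
    (h2 : S.cnt.length ≤ n) (h3 : ∀ k, (S.inn k).length ≤ n) :
    ∃ s', Runs c lit tpl (n + 1) ⟨some (.inl .wipe), s, S.fn⟩
      ⟨some (.inl .flush), s', Contents.fn { S with tpl := [], cnt := [], inn := fun _ => [] }⟩ := by
  induction n generalizing s S with
  | zero =>
    have e1 : S.tpl = [] := List.length_eq_zero_iff.1 (by omega)
    have e2 : S.cnt = [] := List.length_eq_zero_iff.1 (by omega)
    have e3 : ∀ k, S.inn k = [] := fun k => List.length_eq_zero_iff.1 (by have := h3 k; omega)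
    refine ⟨{ s with ok := false }, Runs.single ((step_wipe s S false (by simp [e1, e2, e3])).trans ?_)⟩
    simp only [e1, e2, e3, List.tail_nil]
    rfl
  | succ n ih =>
    obtain ⟨s', hs'⟩ := ih { s with ok := true }
      { S with tpl := S.tpl.tail, cnt := S.cnt.tail, inn := fun k => (S.inn k).tail }
      (by simp; omega) (by simp; omega) (fun k => by have := h3 k; simp; omega)
    have hstep := step_wipe (lit := lit) (tpl := tpl) s S _ rfl
    cases hb : (S.tpl.head?.isSome || S.cnt.head?.isSome || (S.inn .main).head?.isSome ||
      (S.inn .rev).head?.isSome || (S.inn .aux).head?.isSome || (S.inn .stack).head?.isSome) with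
    | true =>
      rw [hb] at hstep
      exact ⟨s', Runs.head hstep hs'⟩
    | false =>
      rw [hb] at hstep
      simp only [Bool.or_eq_false_iff, Option.isSome_eq_false_iff,
        Option.isNone_iff_eq_none, List.head?_eq_none_iff] at hb
      obtain ⟨⟨⟨⟨⟨e1, e2⟩, e3⟩, e4⟩, e5⟩, e6⟩ := hb
      have e : ∀ k, S.inn k = [] := fun k => by cases k <;> assumption
      refine ⟨{ s with ok := false }, (Runs.single (hstep.trans ?_)).mono (by omega)⟩
      simp only [e1, e2, e, List.tail_nil]
      rfl

theorem runs_flush (ts : List Token) (s : State c) (S : Contents) (hS : S.acc = ts) :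
    Runs c lit tpl (ts.length + 1) ⟨some (.inl .flush), s, S.fn⟩
      ⟨none, State.init c, Contents.fn { S with acc := [], out := ts.reverse ++ S.out }⟩ := by
  induction ts generalizing s S with
  | nil => exact Runs.single (by simp [program, hS])
  | cons t ts ih =>
    refine Runs.head (b := ⟨some (.inl .flush), { s with ltr := some (false, some t) },
      Contents.fn { S with acc := ts, out := t :: S.out }⟩) ?_ ?_
    · simp [program, hS]
    · rw [List.reverse_cons, List.append_assoc]
      exact ih _ _ rfl

end

/-! ### The machine day by day: its output and its running time -/

theorem unaryEncodeNat_eq (n : ℕ) : Computability.unaryEncodeNat n = List.replicate n true := by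
  induction n with
  | zero => rfl
  | succ n ih => rw [List.replicate_succ, ← ih]; rfl

theorem length_fill_le (m : Bool) (i : ℕ) (ls : List Letter) :
    (fill m i ls).length ≤ ls.length * (i + 1) := by
  induction ls with
  | nil => simp [fill]
  | cons l ls ih =>
    rw [fill_cons, List.length_append, List.length_cons, Nat.succ_mul]
    have : (if l.1 = m then (l.2.elim (List.replicate i Token.one) fun t => [t]) else []).length
        ≤ i + 1 := by
      split_ifs
      · cases l.2 <;> simp
      · simp
    omega

theorem toLab_coe (c : Code) {l : Λ'} (h : l ∈ codeSupp c Cont'.halt) : (toLab c l).1 = l := by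
  unfold toLab
  rw [dif_pos h]

section
variable {c : Code} {F : ℕ → ℕ} {G : ℕ → List Letter} {lit : List Token}

/-- What has been written before day `i`. -/
def written (lit : List Token) (G : ℕ → List Letter) (κ : ℕ → ℕ) (i : ℕ) : List Token :=
  lit ++ (List.range i).flatMap fun j => fill false j (G (κ j))

theorem written_succ (lit : List Token) (G : ℕ → List Letter) (κ : ℕ → ℕ) (i : ℕ) :
    written lit G κ (i + 1) = written lit G κ i ++ fill false i (G (κ i)) := by
  simp [written, List.range_succ]

theorem length_written_le {κ : ℕ → ℕ} {g : ℕ}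
    (hg : ∀ i, (G (κ i)).length ≤ g + 2 * i + 1) (i : ℕ) :
    (written lit G κ i).length ≤ lit.length + i * ((g + 2 * i + 1) * (i + 1)) := by
  induction i with
  | zero => simp [written]
  | succ i ih =>
    rw [written_succ, List.length_append]
    have h1 := (length_fill_le false i (G (κ i))).trans (Nat.mul_le_mul_right (i + 1) (hg i))
    have h2 : (i + 1) * ((g + 2 * (i + 1) + 1) * (i + 1 + 1)) ≥
        i * ((g + 2 * i + 1) * (i + 1)) + (g + 2 * i + 1) * (i + 1) := by
      have h3 : (g + 2 * i + 1) * (i + 1) ≤ (g + 2 * (i + 1) + 1) * (i + 1 + 1) :=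
        Nat.mul_le_mul (by omega) (by omega)
      nlinarith
    omega

/-- The state agrees with the one of the iterated computation before day `i`. -/
def Agrees (c : Code) (i : ℕ) (s : State c) : Prop :=
  s.var = (Inner.after c i).var ∧ s.lab.1 = (Inner.after c i).lab ∧ s.num = 0

/-- The contents of the stacks before day `i`, if there are `n` days. -/
def dayContents (c : Code) (lit : List Token) (G : ℕ → List Letter) (n i : ℕ) : Contents where
  inp := List.replicate (n - i) true
  out := []
  acc := (written lit G (fun j => (Inner.after c j).round) i).reverse
  tpl := G (Inner.after c i).round
  read := []
  cnt := List.replicate i ()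
  tmp := []
  inn := (Inner.after c i).stk

/-- Apart from the built-in `G 0`, a template comes into use only after its code has been written on
the main stack, whose height is linear in the number of days. The polynomial time bound rests on
this. -/
theorem length_template_le (hc : ∀ k, c.eval [k] = pure [F k, k + 1])
    (hF : ∀ k, F k = encodeTemplate (G (k + 1)).reverse) (i : ℕ) :
    (G (Inner.after c i).round).length ≤ (G 0).length + 2 * i + 1 := by
  induction i with
  | zero => simp [Inner.after_zero, Inner.start]
  | succ i ih =>
    rw [Inner.after_succ]
    unfold Inner.next
    split
    next => simp only; omega
    next v S heq =>
      have hh := (Inner.valid_after c i).halted hc (by rw [heq])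
      have h1 := length_stepAux_le (tr (Inner.after c i).lab) (Inner.after c i).var
        (Inner.after c i).stk K'.main
      have h2 := pushes_tr (Inner.after c i).lab
      have h3 := Inner.length_after_le hc i K'.main
      rw [hh] at h1
      simp only [K'.elim, trList, List.length_append, List.length_cons, hF] at h1
      have h4 := length_le_trNat_encodeTemplate (G ((Inner.after c i).round + 1)).reverse
      rw [List.length_reverse] at h4
      simp only [Inner.start]
      omega

theorem step_running (l : Lab c) (s : State c) (S : Contents) {l' : Λ'} {v : Option Γ'}
    {T : K' → List Γ'} (h : TM2.stepAux (tr l.1) s.var S.inn = ⟨some l', v, T⟩)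
    (tpl : List Letter) :
    TM2.step (program c lit tpl) ⟨some (.inr l), s, S.fn⟩ =
      some ⟨some (.inl .day), { s with var := v, lab := toLab c l' },
        Contents.fn { S with inn := T }⟩ :=
  congrArg some ((stepAux_lift (tr l.1) s S).trans (by rw [h]))

theorem step_halting (l : Lab c) (s : State c) (S : Contents) {v : Option Γ'}
    {T : K' → List Γ'} (h : TM2.stepAux (tr l.1) s.var S.inn = ⟨none, v, T⟩)
    (tpl : List Letter) :
    TM2.step (program c lit tpl) ⟨some (.inr l), s, S.fn⟩ =
      some ⟨some (.inl .clear), { s with var := v }, Contents.fn { S with inn := T }⟩ :=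
  congrArg some ((stepAux_lift (tr l.1) s S).trans (by rw [h]))

theorem runs_day (hc : ∀ k, c.eval [k] = pure [F k, k + 1])
    (hF : ∀ k, F k = encodeTemplate (G (k + 1)).reverse) {n i : ℕ} (hi : i < n) {s : State c}
    (hs : Agrees c i s) :
    ∃ s', Agrees c (i + 1) s' ∧
      Runs c lit (G 0) (((G 0).length + 2 * i + 1) * (2 * i + 5) + 2 * i + 9)
        ⟨some (.inl .day), s, (dayContents c lit G n i).fn⟩
        ⟨some (.inl .day), s', (dayContents c lit G n (i + 1)).fn⟩ := by
  obtain ⟨hv, hl, hnum⟩ := hs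
  set I := Inner.after c i with hI
  set S₀ := dayContents c lit G n i with hS₀
  have hlen := length_template_le hc hF i
  have r1 : Runs c lit (G 0) 1 ⟨some (.inl .day), s, S₀.fn⟩
      ⟨some (.inl .write), { s with mode := false },
        Contents.fn { S₀ with inp := List.replicate (n - (i + 1)) true }⟩ := by
    refine Runs.single ?_
    have : S₀.inp = true :: List.replicate (n - (i + 1)) true := by
      rw [← List.replicate_succ]
      simp only [hS₀, dayContents]
      congr 1
      omega
    simp [program, this]
  have r2 := r1.trans (runs_write i (G I.round) { s with mode := false }
    { S₀ with inp := List.replicate (n - (i + 1)) true } rfl rfl rfl)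
  have r3 := r2.trans (runs_restore_definitions (G I.round).reverse _ _
    (by simp [hS₀, dayContents]) rfl)
  have hw : (fill false i (G I.round)).reverse ++ S₀.acc =
      (written lit G (fun j => (Inner.after c j).round) (i + 1)).reverse := by
    rw [written_succ, List.reverse_append]
    rfl
  have hafter := Inner.after_succ c i
  rw [← hI] at hafter
  rw [List.reverse_reverse, hw] at r3
  cases hstep : TM2.stepAux (tr I.lab) I.var I.stk with
  | mk l v T =>
    have hstep' := hstep
    rw [← hl, ← hv] at hstep'
    cases l with
    | some l =>
      have hnext : Inner.after c (i + 1) = ⟨I.round, l, v, T⟩ := by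
        rw [hafter, Inner.next, hstep]
      have r4 := r3.trans (Runs.single (step_running s.lab _ _ hstep' _))
      refine ⟨{ s with mode := false, ltr := none, ok := false, var := v, lab := toLab c l },
        ⟨?_, ?_, hnum⟩, ?_⟩
      · rw [hnext]
      · rw [hnext]
        refine toLab_coe c ?_
        have := (Inner.valid_after c (i + 1)).lab_mem
        rwa [hnext] at this
      · have hfin : (dayContents c lit G n (i + 1)) =
            { dayContents c lit G n (i + 1) with tpl := G I.round ++ [], inn := T } := by
          simp only [dayContents, hnext, List.append_nil]
        rw [hfin]
        refine r4.mono ?_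
        simp only [List.length_reverse]
        nlinarith
    | none =>
      have hnext : Inner.after c (i + 1) = Inner.start c (I.round + 1) := by
        rw [hafter, Inner.next, hstep]
      have hT : T = K'.elim (trList [F I.round, I.round + 1]) [] [] [] := by
        have := (Inner.valid_after c i).halted hc (by rw [← hI, hstep])
        rwa [← hI, hstep] at this
      have r4 := r3.trans (Runs.single (step_halting s.lab _ _ hstep' _))
      have r5 := r4.trans (runs_clear (G I.round ++ []) _ _ rfl)
      have r6 := r5.trans (runs_load (G (I.round + 1)).reverse (trList [I.round + 1]) _ _ hnum
        (by rw [hT, hF]; rfl))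
      refine ⟨{ s with
        mode := false, ltr := none, ok := false, var := none, lab := firstLab c, num := 0 }, ⟨?_, ?_, rfl⟩, ?_⟩
      · rw [hnext]; rfl
      · rw [hnext]; rfl
      -- The load has consumed `F I.round`; the remaining `trList [I.round + 1]` is the main stack
      -- with which the next round starts.
      · have hfin : (dayContents c lit G n (i + 1)) =
            { dayContents c lit G n (i + 1) with
              tpl := (G (I.round + 1)).reverse.reverse ++ [],
              inn := Function.update T .main (trList [I.round + 1]) } := by
          rw [hT, K'.elim_update_main]
          simp only [dayContents, hnext, List.reverse_reverse, List.append_nil, Inner.start]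
        rw [hfin]
        refine r6.mono ?_
        have h1 := length_stepAux_le (tr I.lab) I.var I.stk K'.main
        have h2 := pushes_tr I.lab
        have h3 := Inner.length_after_le hc i K'.main
        rw [hstep, hT] at h1
        simp only [K'.elim, trList, List.length_append, List.length_cons, hF] at h1
        rw [← hI] at h3
        simp only [List.length_reverse, List.length_append, List.length_nil]
        nlinarith

theorem runs_days (hc : ∀ k, c.eval [k] = pure [F k, k + 1])
    (hF : ∀ k, F k = encodeTemplate (G (k + 1)).reverse) (n i : ℕ) (hi : i ≤ n) :
    ∃ s', Agrees c i s' ∧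
      Runs c lit (G 0) (1 + i * (((G 0).length + 2 * n + 1) * (2 * n + 5) + 2 * n + 9))
        ⟨some (.inl .start), State.init c,
          Contents.fn ⟨List.replicate n true, [], [], [], [], [], [], fun _ => []⟩⟩
        ⟨some (.inl .day), s', (dayContents c lit G n i).fn⟩ := by
  induction i with
  | zero =>
    refine ⟨State.init c, ⟨rfl, rfl, rfl⟩, ?_⟩
    have h := runs_start (c := c) (lit := lit) (tpl := G 0) (State.init c) (List.replicate n true)
    simpa [dayContents, Inner.after_zero, Inner.start, written] using h
  | succ i ih =>
    obtain ⟨s, hs, hr⟩ := ih (by omega)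
    obtain ⟨s', hs', hr'⟩ := runs_day (lit := lit) hc hF (show i < n by omega) hs
    refine ⟨s', hs', (hr.trans hr').mono ?_⟩
    have h1 : ((G 0).length + 2 * i + 1) * (2 * i + 5) ≤
        ((G 0).length + 2 * n + 1) * (2 * n + 5) := Nat.mul_le_mul (by omega) (by omega)
    nlinarith

theorem runs_end (hc : ∀ k, c.eval [k] = pure [F k, k + 1])
    (hF : ∀ k, F k = encodeTemplate (G (k + 1)).reverse) (n : ℕ) (s : State c) :
    Runs c lit (G 0) (((G 0).length + 2 * n + 1) * (3 * n + 6) + 6 +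
        lit.length + n * (((G 0).length + 2 * n + 1) * (n + 1)))
      ⟨some (.inl .day), s, (dayContents c lit G n n).fn⟩
      ⟨none, State.init c, Contents.fn ⟨[], written lit G (fun j => (Inner.after c j).round) n ++
        fill true n (G (Inner.after c n).round), [], [], [], [], [], fun _ => []⟩⟩ := by
  set I := Inner.after c n with hI
  set S₀ := dayContents c lit G n n with hS₀
  have hlen := length_template_le hc hF n
  have r1 : Runs c lit (G 0) 1 ⟨some (.inl .day), s, S₀.fn⟩
      ⟨some (.inl .write), { s with mode := true }, Contents.fn { S₀ with inp := [] }⟩ := by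
    refine Runs.single ?_
    simp [program, hS₀, dayContents]
  have r2 := r1.trans (runs_write n (G I.round) { s with mode := true }
    { S₀ with inp := [] } rfl rfl rfl)
  have r3 := r2.trans (runs_restore_orders (G I.round).reverse _ _
    (by simp [hS₀, dayContents]) rfl)
  obtain ⟨s', r4⟩ := runs_wipe (c := c) (lit := lit) (tpl := G 0)
    ((G 0).length + 2 * n + 1) { s with mode := true, ltr := none, ok := false }
    { S₀ with
      inp := [], acc := (fill true n (G I.round)).reverse ++ S₀.acc,
      tpl := (G I.round).reverse.reverse ++ [], read := [] }
    (by simpa using hlen) (by simp [hS₀, dayContents]; omega)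
    (fun k => (Inner.length_after_le hc n k).trans (by omega))
  have r5 := r3.trans (r4.trans (runs_flush _ _ _ rfl))
  have hout : ((fill true n (G I.round)).reverse ++ S₀.acc).reverse ++ S₀.out =
      written lit G (fun j => (Inner.after c j).round) n ++ fill true n (G I.round) := by
    simp [hS₀, dayContents]
  rw [← hout]
  refine r5.mono ?_
  have h1 := length_written_le (lit := lit) (length_template_le hc hF) n
  have h2 := (length_fill_le true n (G I.round)).trans (Nat.mul_le_mul_right (n + 1) hlen)
  simp only [List.length_append, List.length_reverse]
  have h3 : S₀.acc.length = (written lit G (fun j => (Inner.after c j).round) n).length := by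
    simp [hS₀, dayContents]
  rw [h3]
  nlinarith

theorem runs_total (hc : ∀ k, c.eval [k] = pure [F k, k + 1])
    (hF : ∀ k, F k = encodeTemplate (G (k + 1)).reverse) (n : ℕ) :
    Runs c lit (G 0) (1 + n * (((G 0).length + 2 * n + 1) * (2 * n + 5) + 2 * n + 9) +
        (((G 0).length + 2 * n + 1) * (3 * n + 6) + 6 +
        lit.length + n * (((G 0).length + 2 * n + 1) * (n + 1))))
      ⟨some (.inl .start), State.init c,
        Contents.fn ⟨List.replicate n true, [], [], [], [], [], [], fun _ => []⟩⟩
      ⟨none, State.init c, Contents.fn ⟨[], written lit G (fun j => (Inner.after c j).round) n ++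
        fill true n (G (Inner.after c n).round), [], [], [], [], [], fun _ => []⟩⟩ := by
  obtain ⟨s, -, hs⟩ := runs_days (lit := lit) hc hF n n le_rfl
  exact hs.trans (runs_end hc hF n s)

end

/-- For a computable sequence of templates there is a way to slow it down, such that a trader who
on each day adds definitions to those of the day before, and then gives orders, according to the
templates, is efficiently computable. -/
theorem exists_slowdown (lit : List Token) {G : ℕ → List Letter} (hG : Computable G) :
    ∃ κ : ℕ → ℕ, Function.Surjective κ ∧ ∀ {L : PropLanguage} (T : ℕ → Strategy L),
      (∀ n, (T n).code = lit ++ ((List.range n).flatMap fun j => fill false j (G (κ j))) ++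
        fill true n (G (κ n))) → EfficientlyComputable T := by
  -- The template `G 0` is built into the machine, so round `k` is used to compute the one for round
  -- `k + 1`.
  set F : ℕ → ℕ := fun k => encodeTemplate (G (k + 1)).reverse with hF
  have hFc : Computable F := primrec_encodeTemplate.to_comp.comp
    (Primrec.list_reverse.to_comp.comp (hG.comp Computable.succ))
  obtain ⟨c, hc⟩ := exists_code_iterating hFc
  refine ⟨fun i => (Inner.after c i).round, fun k => ?_, fun {L} T hT => ?_⟩
  · obtain ⟨i, hi⟩ := Inner.round_surjective hc k
    exact ⟨i, by simp only [hi]; rfl⟩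
  · let X : Polynomial ℕ := Polynomial.X
    let g : Polynomial ℕ := Polynomial.C (G 0).length + 2 * X + 1
    refine ⟨{
      tm := machine c lit (G 0)
      inputAlphabet := Equiv.refl Bool
      outputAlphabet := Equiv.refl Token
      time := 1 + X * (g * (2 * X + 5) + 2 * X + 9) +
        (g * (3 * X + 6) + 6 + Polynomial.C lit.length + X * (g * (X + 1)))
      outputsFun := fun n => ?_ }⟩
    have h := runs_total (lit := lit) hc (fun _ => rfl) n
    choose t ht he using h
    refine ⟨⟨t, ?_⟩, ?_⟩
    · have hin : initList (machine c lit (G 0))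
          (List.map (Equiv.refl Bool).invFun (Computability.unaryEncodeNat n)) =
          (⟨some (.inl .start), State.init c,
            Contents.fn ⟨List.replicate n true, [], [], [], [], [], [], fun _ => []⟩⟩ :
            Conf c) := by
        rw [unaryEncodeNat_eq]
        unfold initList
        congr 1
        funext k
        cases k <;> simp [machine, Contents.fn]
        rfl
      have hout : haltList (machine c lit (G 0))
          (List.map (Equiv.refl Token).invFun (T n).code) =
          (⟨none, State.init c, Contents.fn ⟨[], (T n).code, [], [], [], [], [],
            fun _ => []⟩⟩ : Conf c) := by
        unfold haltList
        congr 1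
        funext k
        cases k <;> simp [machine, Contents.fn]
        rfl
      rw [hT n] at hout
      have := he
      rw [← hin] at this
      rw [hT n]
      simp only [Option.map_some]
      erw [hout]
      exact this
    · have hl : (Computability.unaryEncodeNat n).length = n := by
        rw [unaryEncodeNat_eq, List.length_replicate]
      refine ht.trans (le_of_eq ?_)
      simp [X, g, hl]

end Writer

end LogicalInduction

namespace LogicalInduction

/-! ### Traders that follow a rule -/

/-- A rule for trading: an expression in the present state (the number of shares bought so far) and
the present price, whose value is the number of shares to buy. -/
inductive Rule where
  | state
  | price
  | const (q : ℚ)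
  | add (r s : Rule)
  | mul (r s : Rule)
  | max (r s : Rule)

namespace Rule

/-- The value of the rule. -/
noncomputable def eval (v p : ℝ) : Rule → ℝ
  | .state => v
  | .price => p
  | .const q => q
  | .add r s => r.eval v p + s.eval v p
  | .mul r s => r.eval v p * s.eval v p
  | .max r s => Max.max (r.eval v p) (s.eval v p)

/-- The rule as a feature, if the state and the price are given as features. -/
def toFeature {L : PropLanguage} (v p : Feature L) : Rule → Feature L
  | .state => v
  | .price => p
  | .const q => .rat q
  | .add r s => .add (r.toFeature v p) (s.toFeature v p)
  | .mul r s => .mul (r.toFeature v p) (s.toFeature v p)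
  | .max r s => .max (r.toFeature v p) (s.toFeature v p)

/-- The string of the rule as a feature, if those of the state and the price are given, with holes
for the day. -/
def pattern (v p : List (Option Token)) : Rule → List (Option Token)
  | .state => v
  | .price => p
  | .const q => (Token.rat :: ratCode q).map some
  | .add r s => some Token.add :: (r.pattern v p ++ s.pattern v p)
  | .mul r s => some Token.mul :: (r.pattern v p ++ s.pattern v p)
  | .max r s => some Token.max :: (r.pattern v p ++ s.pattern v p)

theorem eval_toFeature {L : PropLanguage} (V : ℕ → Sentence L → ℝ) (env : List ℝ)
    (v p : Feature L) (R : Rule) :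
    (R.toFeature v p).eval V env = R.eval (v.eval V env) (p.eval V env) := by
  induction R <;> simp_all [toFeature, eval, Feature.eval]

theorem wellFormed_toFeature {L : PropLanguage} {n k : ℕ} {v p : Feature L}
    (hv : v.WellFormed n k) (hp : p.WellFormed n k) (R : Rule) :
    (R.toFeature v p).WellFormed n k := by
  induction R <;> simp_all [toFeature, Feature.WellFormed]

end Rule

/-! ### Strings of features as patterns with holes for the day -/

/-- The string of a pattern, the holes being filled with `i`. -/
def fillPattern (i : ℕ) (ls : List (Option Token)) : List Token :=
  ls.flatMap fun o => o.elim (List.replicate i Token.one) fun t => [t]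

theorem fillPattern_append (i : ℕ) (l₁ l₂ : List (Option Token)) :
    fillPattern i (l₁ ++ l₂) = fillPattern i l₁ ++ fillPattern i l₂ := by
  simp [fillPattern]

theorem fillPattern_cons_some (i : ℕ) (t : Token) (l : List (Option Token)) :
    fillPattern i (some t :: l) = t :: fillPattern i l := rfl

theorem fillPattern_cons_none (i : ℕ) (l : List (Option Token)) :
    fillPattern i (none :: l) = List.replicate i Token.one ++ fillPattern i l := rfl

theorem fillPattern_nil (i : ℕ) : fillPattern i [] = [] := rfl

theorem fillPattern_map_some (i : ℕ) (l : List Token) : fillPattern i (l.map some) = l := by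
  induction l with
  | nil => rfl
  | cons t l ih => rw [List.map_cons, fillPattern_cons_some, ih]

theorem fill_map_self (m : Bool) (i : ℕ) (l : List (Option Token)) :
    fill m i (l.map (Prod.mk m)) = fillPattern i l := by
  simp [fill, fillPattern, List.flatMap_map]

theorem fill_map_of_ne {m m' : Bool} (h : m' ≠ m) (i : ℕ) (l : List (Option Token)) :
    fill m i (l.map (Prod.mk m')) = [] := by
  simp [fill, List.flatMap_map, h]

/-- The sum of the prices of some sentences on day `i`. -/
def priceSum {L : PropLanguage} (i : ℕ) (Φ : List (Sentence L)) : Feature L :=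
  Φ.foldr (fun φ ξ => .add (.price i φ) ξ) (.rat 0)

/-- The pattern of the sum of the prices of some sentences, given by their strings. -/
def priceSumPattern (cs : List (List Token)) : List (Option Token) :=
  cs.foldr (fun s r => [some Token.add, some Token.price, none, some Token.done] ++
    (s.map some ++ r)) ((Token.rat :: ratCode 0).map some)

/-- The pattern of the variable for the state. -/
def statePattern : List (Option Token) := [some Token.var, none, some Token.done]

theorem eval_priceSum {L : PropLanguage} (V : ℕ → Sentence L → ℝ) (env : List ℝ) (i : ℕ)
    (Φ : List (Sentence L)) : (priceSum i Φ).eval V env = (Φ.map (V i)).sum := by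
  induction Φ with
  | nil => simp [priceSum, Feature.eval]
  | cons φ Φ ih =>
    change V i φ + (priceSum i Φ).eval V env = _
    rw [ih, List.map_cons, List.sum_cons]

theorem wellFormed_priceSum {L : PropLanguage} {n k i : ℕ} (hi : i ≤ n) (Φ : List (Sentence L)) :
    (priceSum i Φ).WellFormed n k := by
  induction Φ with
  | nil => trivial
  | cons φ Φ ih => exact ⟨hi, ih⟩

theorem fillPattern_priceSumPattern {L : PropLanguage} (i : ℕ) (Φ : List (Sentence L)) :
    fillPattern i (priceSumPattern (Φ.map Sentence.code)) = (priceSum i Φ).code := by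
  induction Φ with
  | nil => exact fillPattern_map_some _ _
  | cons φ Φ ih =>
    change fillPattern i ([some Token.add, some Token.price, none, some Token.done] ++
      (φ.code.map some ++ priceSumPattern (Φ.map Sentence.code))) =
        Token.add :: ((Token.price :: (unaryCode i ++ φ.code)) ++ (priceSum i Φ).code)
    rw [fillPattern_append, fillPattern_append, fillPattern_map_some, ih]
    simp [fillPattern_cons_some, fillPattern_cons_none, fillPattern_nil, unaryCode]

theorem fillPattern_statePattern {L : PropLanguage} (i : ℕ) :
    fillPattern i statePattern = (Feature.var i : Feature L).code := by
  simp [statePattern, fillPattern_cons_some, fillPattern_cons_none, fillPattern_nil, unaryCode,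
    Feature.code]

theorem fillPattern_pattern {L : PropLanguage} (i : ℕ) {v p : Feature L}
    {v' p' : List (Option Token)} (hv : fillPattern i v' = v.code) (hp : fillPattern i p' = p.code)
    (R : Rule) : fillPattern i (R.pattern v' p') = (R.toFeature v p).code := by
  induction R <;> simp_all [Rule.pattern, Rule.toFeature, Feature.code, fillPattern_cons_some,
    fillPattern_append, fillPattern_map_some]

/-- The feature that tells how much to buy on day `i`. -/
def amount {L : PropLanguage} (R : Rule) (i : ℕ) (Φ : List (Sentence L)) : Feature L :=
  R.toFeature (.var i) (priceSum i Φ)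

/-- The pattern of the feature that tells how much to buy. -/
def amountPattern (R : Rule) (cs : List (List Token)) : List (Option Token) :=
  R.pattern statePattern (priceSumPattern cs)

theorem fillPattern_amountPattern {L : PropLanguage} (R : Rule) (i : ℕ) (Φ : List (Sentence L)) :
    fillPattern i (amountPattern R (Φ.map Sentence.code)) = (amount R i Φ).code :=
  fillPattern_pattern i (fillPattern_statePattern i) (fillPattern_priceSumPattern i Φ) R

/-- The trader who on day `n` buys equally many shares of each sentence of `Φ n`, according to
the rule `R`. -/
def trader {L : PropLanguage} (R : Rule) (Φ : ℕ → List (Sentence L)) (n : ℕ) : Strategy L where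
  -- The leading definition is the empty initial holding, so `var i` is the holding before day `i`.
  -- Variables keep the strategy short: a rule may mention the state several times, and substituting
  -- the holdings could multiply the length every day.
  defs := .rat 0 :: (List.range n).map fun i => .add (.var i) (amount R i (Φ i))
  orders := (Φ n).map fun φ => (φ, amount R n (Φ n))

/-- The template of the definition and the orders for a list of sentences, given by strings. -/
def template (R : Rule) (cs : List (List Token)) : List Letter :=
  (some Token.define :: some Token.add :: (statePattern ++ amountPattern R cs)).map
      (Prod.mk false) ++
    (cs.flatMap fun s => some Token.trade :: (s.map some ++ amountPattern R cs)).map (Prod.mk true)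

theorem fill_false_template {L : PropLanguage} (R : Rule) (i : ℕ) (Φ : List (Sentence L)) :
    fill false i (template R (Φ.map Sentence.code)) =
      Token.define :: (Feature.add (.var i) (amount R i Φ)).code := by
  rw [template, fill_append, fill_map_self, fill_map_of_ne (by simp), List.append_nil,
    fillPattern_cons_some, fillPattern_cons_some, fillPattern_append,
    fillPattern_statePattern (L := L), fillPattern_amountPattern]
  rfl

theorem fill_true_template {L : PropLanguage} (R : Rule) (i : ℕ) (Φ : List (Sentence L)) :
    fill true i (template R (Φ.map Sentence.code)) =
      (Φ.map fun φ => (φ, amount R i Φ)).flatMap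
        fun o => Token.trade :: (o.1.code ++ o.2.code) := by
  rw [template, fill_append, fill_map_of_ne (by simp), fill_map_self, List.nil_append,
    List.flatMap_map, List.flatMap_map]
  have h := fillPattern_amountPattern R i Φ
  -- The amount depends on the whole list, so it has to be frozen before the induction on the list.
  generalize amountPattern R (Φ.map Sentence.code) = a at h
  generalize amount R i Φ = ξ at h
  induction Φ with
  | nil => rfl
  | cons φ Φ ih =>
    rw [List.flatMap_cons, fillPattern_append, ih, List.flatMap_cons, fillPattern_cons_some,
      fillPattern_append, fillPattern_map_some, h]

theorem primrec_mapSome : Primrec fun s : List Token => s.map some :=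
  Primrec.list_map Primrec.id (Primrec.option_some.comp Primrec.snd).to₂

theorem primrec_priceSumPattern : Primrec priceSumPattern := by
  unfold priceSumPattern
  refine Primrec.list_foldr (f := fun cs : List (List Token) => cs)
    (h := fun _ p => [some Token.add, some Token.price, none, some Token.done] ++
      (p.1.map some ++ p.2)) Primrec.id (Primrec.const _) ?_
  refine Primrec.list_append.comp (Primrec.const _) (Primrec.list_append.comp ?_ ?_)
  · exact primrec_mapSome.comp (Primrec.fst.comp Primrec.snd)
  · exact Primrec.snd.comp Primrec.snd

theorem primrec_amountPattern (R : Rule) : Primrec (amountPattern R) := by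
  unfold amountPattern
  induction R with
  | state => exact Primrec.const _
  | price => exact primrec_priceSumPattern
  | const q => exact Primrec.const _
  | add r s hr hs => exact Primrec.list_cons.comp (Primrec.const _) (Primrec.list_append.comp hr hs)
  | mul r s hr hs => exact Primrec.list_cons.comp (Primrec.const _) (Primrec.list_append.comp hr hs)
  | max r s hr hs => exact Primrec.list_cons.comp (Primrec.const _) (Primrec.list_append.comp hr hs)

theorem primrec_template (R : Rule) : Primrec (template R) := by
  unfold template
  have ha := primrec_amountPattern R
  refine Primrec.list_append.comp (Primrec.list_map ?_ ?_) (Primrec.list_map ?_ ?_)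
  · exact Primrec.list_cons.comp (Primrec.const _) (Primrec.list_cons.comp (Primrec.const _)
      (Primrec.list_append.comp (Primrec.const _) ha))
  · exact (Primrec.pair (Primrec.const _) Primrec.snd).to₂
  · refine Primrec.list_flatMap Primrec.id ?_
    exact (Primrec.list_cons.comp (Primrec.const _) (Primrec.list_append.comp
      (primrec_mapSome.comp Primrec.snd) (ha.comp Primrec.fst))).to₂
  · exact (Primrec.pair (Primrec.const _) Primrec.snd).to₂

/-- A trader who follows a rule and turns to the next one of a computable sequence of lists of
sentences when it has been computed is efficiently computable. -/
theorem exists_efficientlyComputable_trader {L : PropLanguage} (R : Rule)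
    {Φ : ℕ → List (Sentence L)} (hΦ : Computable fun k => (Φ k).map Sentence.code) :
    ∃ κ : ℕ → ℕ, Function.Surjective κ ∧
      EfficientlyComputable (trader R fun i => Φ (κ i)) := by
  obtain ⟨κ, hκ, h⟩ := Writer.exists_slowdown
    (Token.define :: (Feature.rat 0 : Feature L).code) ((primrec_template R).to_comp.comp hΦ)
  refine ⟨κ, hκ, h _ fun n => ?_⟩
  simp only [fill_false_template, fill_true_template, Strategy.code, trader, List.flatMap_cons,
    List.flatMap_map]

theorem isTrader_trader {L : PropLanguage} (R : Rule) (Φ : ℕ → List (Sentence L)) :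
    IsTrader (trader R Φ) := by
  intro n
  refine ⟨fun k hk => ?_, fun o ho => ?_⟩
  · cases k with
    | zero => trivial
    | succ k =>
      simp only [trader, List.length_cons, List.length_map, List.length_range,
        Nat.add_lt_add_iff_right] at hk
      simp only [trader, List.getElem_cons_succ, List.getElem_map, List.getElem_range]
      have hv : (Feature.var k : Feature L).WellFormed n (k + 1) := Nat.lt_succ_self k
      exact ⟨hv, Rule.wellFormed_toFeature hv (wellFormed_priceSum hk.le _) R⟩
  · obtain ⟨φ, -, rfl⟩ := List.mem_map.1 ho
    refine Rule.wellFormed_toFeature ?_ (wellFormed_priceSum le_rfl _) R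
    simp [Feature.WellFormed, trader]

/-! ### Holdings and net worth of a trader who follows a rule -/

/-- The number of shares of each sentence that have been bought before day `i`. -/
noncomputable def holding (R : Rule) (p : ℕ → ℝ) : ℕ → ℝ
  | 0 => 0
  | i + 1 => holding R p i + R.eval (holding R p i) (p i)

section
variable {L : PropLanguage} (R : Rule) (Φ : ℕ → List (Sentence L)) (V : ℕ → Sentence L → ℝ)

theorem eval_amount (env : List ℝ) (i : ℕ) (Ψ : List (Sentence L)) :
    (amount R i Ψ).eval V env = R.eval (env.getD i 0) (Ψ.map (V i)).sum := by
  rw [amount, Rule.eval_toFeature, eval_priceSum]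
  rfl

/-- The definitions of day `n + 1` extend those of day `n` by one, whose value is the recursion step
of `holding`. -/
theorem env_trader (n : ℕ) :
    (trader R Φ n).env V =
      (List.range (n + 1)).map (holding R fun i => ((Φ i).map (V i)).sum) := by
  induction n with
  | zero => simp [Strategy.env, trader, Feature.eval, holding]
  | succ n ih =>
    have h : (trader R Φ (n + 1)).env V = (trader R Φ n).env V ++
        [(Feature.add (.var n) (amount R n (Φ n))).eval V ((trader R Φ n).env V)] := by
      simp only [Strategy.env, trader, List.range_succ, List.map_append, ← List.cons_append,
        List.foldl_append]
      rfl
    rw [h, ih, List.range_succ (n := n + 1), List.map_append]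
    congr 1
    simp only [Feature.eval, eval_amount, List.map_cons, List.map_nil, holding]
    congr 1
    simp [List.getD_eq_getElem?_getD]

theorem value_trader (n : ℕ) (W : World L) :
    (trader R Φ n).value n V W =
      R.eval (holding R (fun i => ((Φ i).map (V i)).sum) n) ((Φ n).map (V n)).sum *
        (((Φ n).map fun φ => if W φ = true then (1 : ℝ) else 0).sum - ((Φ n).map (V n)).sum) := by
  have h : (amount R n (Φ n)).eval V ((trader R Φ n).env V) =
      R.eval (holding R (fun i => ((Φ i).map (V i)).sum) n) ((Φ n).map (V n)).sum := by
    rw [eval_amount, env_trader]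
    simp [List.getD_eq_getElem?_getD]
  rw [Strategy.value, Strategy.cash]
  simp only [trader, List.map_map, Function.comp_def] at h ⊢
  simp only [h, List.sum_map_mul_left]
  ring

theorem netWorth_trader (n : ℕ) (W : World L) :
    netWorth (trader R Φ) V n W = ∑ i ∈ Finset.range (n + 1),
      (holding R (fun i => ((Φ i).map (V i)).sum) (i + 1) -
        holding R (fun i => ((Φ i).map (V i)).sum) i) *
        (((Φ i).map fun φ => if W φ = true then (1 : ℝ) else 0).sum - ((Φ i).map (V i)).sum) := by
  refine Finset.sum_congr rfl fun i _ => ?_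
  rw [value_trader, holding]
  ring

end

end LogicalInduction

namespace LogicalInduction

open Filter Topology

section
variable {L : PropLanguage} {P : ℕ → Sentence L → ℚ} {D : ℕ → Finset (Sentence L)}

/-- If the net worth of an efficiently computable trader is bounded below, then it is bounded
above. -/
theorem IsLogicalInductor.exists_netWorth_le (hP : IsLogicalInductor P D)
    {T : ℕ → Strategy L} (hT : IsTrader T) (hTc : EfficientlyComputable T) (a : ℝ)
    (ha : ∀ n, ∀ W ∈ pcWorlds (D n : Set (Sentence L)),
      a ≤ netWorth T (fun n φ => (P n φ : ℝ)) n W) :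
    ∃ b, ∀ n, ∀ W ∈ pcWorlds (D n : Set (Sentence L)),
      netWorth T (fun n φ => (P n φ : ℝ)) n W ≤ b := by
  have h := hP.2 T hT hTc
  rw [Exploits, not_and, not_not] at h
  obtain ⟨b, hb⟩ := h ⟨a, by rintro x ⟨n, W, hW, rfl⟩; exact ha n W hW⟩
  exact ⟨b, fun n W hW => hb ⟨n, W, hW, rfl⟩⟩

/-! ### Convergence -/

/-- The rule that keeps the sum of the state and the price between `0` and `w`. -/
def followRule (w : ℚ) : Rule :=
  .add (.max (.mul (.const (-1)) .price) (.mul (.const (-1)) (.max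
    (.mul (.const (-1)) (.add (.const w) (.mul (.const (-1)) .price)))
    (.mul (.const (-1)) .state)))) (.mul (.const (-1)) .state)

theorem eval_followRule (w : ℚ) (v p : ℝ) :
    (followRule w).eval v p = max (-p) (min (w - p) v) - v := by
  have h : ∀ a b : ℝ, -max (-a) (-b) = min a b := fun a b => by rw [max_neg_neg, neg_neg]
  simp only [followRule, Rule.eval]
  push_cast
  rw [← h]
  ring_nf

/-- Purchases end at `h' = -p` and sales at `h' = w - p`. So the cash gained is `(h' - h) * h'`,
plus `w` per share sold, and `(h' - h) * h'` exceeds `(h' ^ 2 - h ^ 2) / 2` by `(h' - h) ^ 2 / 2`.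
-/
theorem follow_step_le {w h h' p : ℝ} (hw : 0 < w) (hh : h' = max (-p) (min (w - p) h)) :
    (h' ^ 2 - h ^ 2) / 2 + w * max 0 (h - h') ≤ (h' - h) * (-p) := by
  rcases le_total h (-p) with h1 | h1
  · have : h' = -p := by rw [hh, min_eq_right (by linarith), max_eq_left h1]
    subst this
    rw [max_eq_left (by linarith)]
    nlinarith [sq_nonneg (-p - h)]
  · rcases le_total h (w - p) with h2 | h2
    · have : h' = h := by rw [hh, min_eq_right h2, max_eq_right h1]
      subst this
      simp
    · have : h' = w - p := by rw [hh, min_eq_left h2, max_eq_right (by linarith)]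
      subst this
      rw [max_eq_right (by linarith)]
      nlinarith [sq_nonneg (w - p - h)]

/-- Holding plus total decrease is monotone and bounded, and so is the total decrease; hence the
holding converges. Since `p i` lies between `-h (i + 1)` and `w - h (i + 1)`, prices eventually vary
by at most `w` plus the variation of the holding. -/
theorem exists_forall_abs_sub_le_of_follow {w B : ℝ} (hw : 0 < w) {p h : ℕ → ℝ}
    (hp : ∀ i, 0 ≤ p i ∧ p i ≤ 1) (hh : ∀ i, h (i + 1) = max (-p i) (min (w - p i) (h i)))
    (hB : ∀ n, ∑ i ∈ Finset.range n, max 0 (h i - h (i + 1)) ≤ B) :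
    ∃ N, ∀ m ≥ N, ∀ n ≥ N, |p m - p n| ≤ 2 * w := by
  set S : ℕ → ℝ := fun n => ∑ i ∈ Finset.range n, max 0 (h i - h (i + 1)) with hS
  have hSmono : Monotone S := monotone_nat_of_le_succ fun n => by
    simp only [hS, Finset.sum_range_succ]
    linarith [le_max_left 0 (h n - h (n + 1))]
  have hSlim := tendsto_atTop_ciSup hSmono ⟨B, by rintro _ ⟨n, rfl⟩; exact hB n⟩
  have hAmono : Monotone fun n => h n + S n := monotone_nat_of_le_succ fun n => by
    simp only [hS, Finset.sum_range_succ]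
    linarith [le_max_right 0 (h n - h (n + 1))]
  have hup : ∀ i, -p i ≤ h (i + 1) ∧ h (i + 1) ≤ w - p i := fun i => by
    rw [hh]
    exact ⟨le_max_left _ _, max_le (by linarith) (min_le_left _ _)⟩
  have hAlim := tendsto_atTop_ciSup hAmono ⟨max (h 0) w + B, by
    rintro _ ⟨n, rfl⟩
    refine add_le_add ?_ (hB n)
    cases n with
    | zero => exact le_max_left _ _
    | succ n => exact le_max_of_le_right (by linarith [(hup n).2, (hp n).1])⟩
  have hcauchy := (hAlim.sub hSlim).cauchySeq
  simp only [add_sub_cancel_right] at hcauchy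
  obtain ⟨N, hN⟩ := Metric.cauchySeq_iff.1 hcauchy w hw
  refine ⟨N, fun m hm n hn => ?_⟩
  have h1 := hN (m + 1) (by omega) (n + 1) (by omega)
  rw [Real.dist_eq, abs_lt] at h1
  rw [abs_le]
  have h2 := hup m
  have h3 := hup n
  constructor <;> linarith [h1.1, h1.2]

/-- The trader with `followRule w` has cash at least `h ^ 2 / 2 + w * (shares sold)` and holds `h`
shares. Since `h ^ 2 / 2 + h ≥ -1 / 2`, the loss is at most `1 / 2` in every world. Without
exploitation the gain in `W₀` is bounded too, and with it the total number of shares sold. -/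
theorem IsLogicalInductor.exists_forall_abs_sub_le (hP : IsLogicalInductor P D)
    {W₀ : World L} (hW₀ : ∀ n, W₀ ∈ pcWorlds (D n : Set (Sentence L))) (φ : Sentence L)
    {w : ℚ} (hw : 0 < w) :
    ∃ N, ∀ m ≥ N, ∀ n ≥ N, |(P m φ : ℝ) - P n φ| ≤ 2 * w := by
  have hw' : (0 : ℝ) < w := by exact_mod_cast hw
  set p : ℕ → ℝ := fun i => P i φ with hp
  set h : ℕ → ℝ := holding (followRule w) p with hh
  have hstep : ∀ i, h (i + 1) = max (-p i) (min (w - p i) (h i)) := fun i => by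
    rw [hh, holding, eval_followRule]
    ring
  obtain ⟨κ, -, hc⟩ := exists_efficientlyComputable_trader (followRule w)
    (Φ := fun _ => [φ]) (Computable.const _)
  have hnet : ∀ n (W : World L), netWorth (trader (followRule w) fun _ => [φ])
      (fun n φ => (P n φ : ℝ)) n W = h (n + 1) * (if W φ = true then 1 else 0) +
        ∑ i ∈ Finset.range (n + 1), (h (i + 1) - h i) * (-p i) := fun n W => by
    rw [netWorth_trader]
    have hsum : h (n + 1) = ∑ i ∈ Finset.range (n + 1), (h (i + 1) - h i) := by
      rw [Finset.sum_range_sub]; simp [hh, holding]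
    rw [hsum, Finset.sum_mul, ← Finset.sum_add_distrib]
    refine Finset.sum_congr rfl fun i _ => ?_
    simp only [List.map_cons, List.map_nil, List.sum_cons, List.sum_nil, add_zero]
    rw [← hp, ← hh]
    ring
  have hgain : ∀ n, h n ^ 2 / 2 + w * ∑ i ∈ Finset.range n, max 0 (h i - h (i + 1)) ≤
      ∑ i ∈ Finset.range n, (h (i + 1) - h i) * (-p i) := by
    intro n
    induction n with
    | zero => simp [hh, holding]
    | succ n ih =>
      rw [Finset.sum_range_succ, Finset.sum_range_succ]
      linarith [follow_step_le hw' (hstep n)]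
  have hneg : ∀ n, 0 ≤ ∑ i ∈ Finset.range n, max 0 (h i - h (i + 1)) := fun n =>
    Finset.sum_nonneg fun i _ => le_max_left _ _
  have hlow : ∀ n (W : World L), -(1 / 2) + w * ∑ i ∈ Finset.range (n + 1),
      max 0 (h i - h (i + 1)) ≤ netWorth (trader (followRule w) fun _ => [φ])
        (fun n φ => (P n φ : ℝ)) n W := fun n W => by
    rw [hnet]
    have := hgain (n + 1)
    split_ifs
    · nlinarith [sq_nonneg (h (n + 1) + 1)]
    · nlinarith [sq_nonneg (h (n + 1))]
  obtain ⟨b, hb⟩ := hP.exists_netWorth_le (isTrader_trader _ _) hc (-(1 / 2)) fun n W _ => by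
    have := hlow n W
    have := mul_nonneg hw'.le (hneg (n + 1))
    linarith
  refine exists_forall_abs_sub_le_of_follow (B := (b + 1 / 2) / w) hw'
    (fun i => ⟨by exact_mod_cast (hP.1.1 i φ).1, by exact_mod_cast (hP.1.1 i φ).2⟩) hstep
    fun n => ?_
  rw [le_div_iff₀ hw']
  have h1 := (hlow n W₀).trans (hb n W₀ (hW₀ n))
  rw [Finset.sum_range_succ] at h1
  nlinarith [le_max_left 0 (h n - h (n + 1))]

/-- The prices of a logical inductor converge. -/
theorem IsLogicalInductor.exists_tendsto (hP : IsLogicalInductor P D)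
    {W₀ : World L} (hW₀ : ∀ n, W₀ ∈ pcWorlds (D n : Set (Sentence L))) (φ : Sentence L) :
    ∃ x : ℝ, Tendsto (fun n => (P n φ : ℝ)) atTop (𝓝 x) := by
  refine cauchySeq_tendsto_of_complete (Metric.cauchySeq_iff.2 fun ε hε => ?_)
  obtain ⟨w, hw, hwε⟩ := exists_rat_btwn (show 0 < ε / 2 by linarith)
  obtain ⟨N, hN⟩ := hP.exists_forall_abs_sub_le hW₀ φ (w := w) (by exact_mod_cast hw)
  refine ⟨N, fun m hm n hn => ?_⟩
  rw [Real.dist_eq]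
  linarith [hN m hm n hn]

/-! ### A lower bound for the prices of true sentences -/

/-- The rule that buys while the price is low in comparison with the number of shares. -/
def collectRule : Rule :=
  .max (.const 0) (.add (.const 1) (.mul (.const (-1)) (.mul
    (.mul (.add (.const 1) .state) (.add (.const 1) .state)) .price)))

theorem eval_collectRule (v p : ℝ) :
    collectRule.eval v p = max 0 (1 - (1 + v) ^ 2 * p) := by
  simp only [collectRule, Rule.eval]
  push_cast
  ring_nf

/-- If anything is bought then `p ≤ 1 / (1 + s) ^ 2`, and since `x ≤ 1` one has `1 + s + x ≤ 2 * (1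
+ s)`. The right-hand side telescopes, which bounds the total cost by `2`. -/
theorem collect_step_le {s x p : ℝ} (hs : 0 ≤ s) (hp : 0 ≤ p)
    (hx : x = max 0 (1 - (1 + s) ^ 2 * p)) : x * p ≤ 2 / (1 + s) - 2 / (1 + (s + x)) := by
  have hx0 : 0 ≤ x := hx ▸ le_max_left _ _
  have hx1 : x ≤ 1 := hx ▸ max_le zero_le_one (by nlinarith [sq_nonneg (1 + s)])
  rcases hx0.eq_or_lt with h0 | h0
  · rw [← h0]; simp
  · have hx' : x = 1 - (1 + s) ^ 2 * p := by
      rw [hx]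
      refine max_eq_right ?_
      by_contra hcon
      rw [hx, max_eq_left (by linarith)] at h0
      exact lt_irrefl _ h0
    have hp1 : (1 + s) ^ 2 * p ≤ 1 := by linarith
    rw [div_sub_div _ _ (by positivity) (by positivity), le_div_iff₀ (by positivity)]
    nlinarith [mul_nonneg h0.le hp, mul_nonneg h0.le hs,
      mul_le_mul_of_nonneg_left hp1 h0.le, mul_nonneg (mul_nonneg h0.le hp) hs,
      mul_le_mul_of_nonneg_left hx1 (mul_nonneg (mul_nonneg h0.le hp) (by linarith : 0 ≤ 1 + s))]

/-- If, in a world that is always plausible, in each list of a computable sequence of lists of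
sentences there is a true one, then the sum of the prices of the sentences of a list has a positive
lower bound, provided that it takes long enough to turn to the next list. -/
theorem IsLogicalInductor.exists_le_sum_price (hP : IsLogicalInductor P D)
    {W₀ : World L} (hW₀ : ∀ n, W₀ ∈ pcWorlds (D n : Set (Sentence L)))
    {Φ : ℕ → List (Sentence L)} (hΦ : Computable fun k => (Φ k).map Sentence.code)
    (htrue : ∀ k, ∃ φ ∈ Φ k, W₀ φ = true) :
    ∃ κ : ℕ → ℕ, Function.Surjective κ ∧ ∃ ε : ℝ, 0 < ε ∧
      ∀ᶠ n in atTop, ε ≤ ((Φ (κ n)).map fun φ => (P n φ : ℝ)).sum := by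
  obtain ⟨κ, hκ, hc⟩ := exists_efficientlyComputable_trader collectRule hΦ
  refine ⟨κ, hκ, ?_⟩
  set p : ℕ → ℝ := fun i => ((Φ (κ i)).map fun φ => (P i φ : ℝ)).sum with hp
  set s : ℕ → ℝ := holding collectRule p with hs
  have hp0 : ∀ i, 0 ≤ p i := fun i => List.sum_nonneg (by
    intro x hx
    obtain ⟨φ, -, rfl⟩ := List.mem_map.1 hx
    exact_mod_cast (hP.1.1 i φ).1)
  have hx : ∀ i, s (i + 1) - s i = max 0 (1 - (1 + s i) ^ 2 * p i) := fun i => by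
    rw [hs, holding, eval_collectRule]
    ring
  have hx0 : ∀ i, 0 ≤ s (i + 1) - s i := fun i => by rw [hx]; exact le_max_left _ _
  have hmono : Monotone s := monotone_nat_of_le_succ fun i => by linarith [hx0 i]
  have hs0 : ∀ i, 0 ≤ s i := fun i => hmono (Nat.zero_le i)
  have hcost : ∀ n, ∑ i ∈ Finset.range n, (s (i + 1) - s i) * p i ≤ 2 := by
    have h1 : ∀ n, ∑ i ∈ Finset.range n, (s (i + 1) - s i) * p i ≤ 2 - 2 / (1 + s n) := by
      intro n
      induction n with
      | zero => simp [hs, holding]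
      | succ n ih =>
        rw [Finset.sum_range_succ]
        have := collect_step_le (hs0 n) (hp0 n) (hx n)
        rw [add_sub_cancel] at this
        linarith
    intro n
    have : 0 ≤ 2 / (1 + s n) := div_nonneg zero_le_two (by linarith [hs0 n])
    linarith [h1 n]
  have hworld : ∀ i (W : World L),
      0 ≤ ((Φ (κ i)).map fun φ => if W φ = true then (1 : ℝ) else 0).sum := fun i W =>
    List.sum_nonneg (by
      intro x hx
      obtain ⟨φ, -, rfl⟩ := List.mem_map.1 hx
      split_ifs <;> norm_num)
  have hnet : ∀ n (W : World L), ∑ i ∈ Finset.range (n + 1), (s (i + 1) - s i) *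
      ((Φ (κ i)).map fun φ => if W φ = true then (1 : ℝ) else 0).sum - 2 ≤
      netWorth (trader collectRule fun i => Φ (κ i)) (fun n φ => (P n φ : ℝ)) n W :=
    fun n W => by
    rw [netWorth_trader]
    simp only [mul_sub, Finset.sum_sub_distrib]
    exact sub_le_sub_left (hcost (n + 1)) _
  obtain ⟨b, hb⟩ := hP.exists_netWorth_le (isTrader_trader _ _) hc (-2) fun n W _ => by
    have h1 := hnet n W
    have h2 : 0 ≤ ∑ i ∈ Finset.range (n + 1), (s (i + 1) - s i) *
        ((Φ (κ i)).map fun φ => if W φ = true then (1 : ℝ) else 0).sum :=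
      Finset.sum_nonneg fun i _ => mul_nonneg (hx0 i) (hworld i W)
    linarith
  have htrue' : ∀ i, 1 ≤ ((Φ (κ i)).map fun φ => if W₀ φ = true then (1 : ℝ) else 0).sum := by
    intro i
    obtain ⟨φ, hφ, hW⟩ := htrue (κ i)
    refine List.single_le_sum (l := (Φ (κ i)).map fun φ => if W₀ φ = true then (1 : ℝ) else 0)
      ?_ 1 (List.mem_map.2 ⟨φ, hφ, by simp [hW]⟩)
    intro x hx
    obtain ⟨ψ, -, rfl⟩ := List.mem_map.1 hx
    split_ifs <;> norm_num
  have hsb : ∀ n, s n ≤ b + 2 := fun n => by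
    have h1 := (hnet n W₀).trans (hb n W₀ (hW₀ n))
    have h2 : ∑ i ∈ Finset.range (n + 1), (s (i + 1) - s i) ≤ ∑ i ∈ Finset.range (n + 1),
        (s (i + 1) - s i) *
          ((Φ (κ i)).map fun φ => if W₀ φ = true then (1 : ℝ) else 0).sum :=
      Finset.sum_le_sum fun i _ => le_mul_of_one_le_right (hx0 i) (htrue' i)
    rw [Finset.sum_range_sub] at h2
    have h3 : s 0 = 0 := rfl
    linarith [hmono (Nat.le_succ n)]
  have hlim := tendsto_atTop_ciSup hmono ⟨b + 2, by rintro _ ⟨n, rfl⟩; exact hsb n⟩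
  have hdiff := ((tendsto_add_atTop_iff_nat 1).2 hlim).sub hlim
  rw [sub_self] at hdiff
  have hpos : 0 < (1 + (b + 2)) ^ 2 := by
    have := (hs0 0).trans (hsb 0)
    positivity
  -- The holding is monotone and at most `b + 2`, so purchases tend to zero. Once `1 - (1 + s n) ^ 2
  -- * p n < 1 / 2`, the price sum is at least this constant.
  refine ⟨1 / (2 * (1 + (b + 2)) ^ 2), by positivity, ?_⟩
  filter_upwards [hdiff.eventually_lt_const (show (0 : ℝ) < 1 / 2 by norm_num)] with n hn
  rw [hx] at hn
  have h1 := (le_max_right _ _).trans_lt hn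
  have h2 : (1 + s n) ^ 2 * p n ≤ (1 + (b + 2)) ^ 2 * p n :=
    mul_le_mul_of_nonneg_right (pow_le_pow_left₀ (by linarith [hs0 n]) (by linarith [hsb n]) 2)
      (hp0 n)
  rw [div_le_iff₀ (by positivity)]
  linarith

end

/-! ### Computable functions of lists -/

section
variable {α β σ : Type*} [Primcodable α] [Primcodable β] [Primcodable σ]

theorem _root_.Computable.list_foldl {f : α → List β} {g : α → σ} {h : α → σ × β → σ}
    (hf : Computable f) (hg : Computable g) (hh : Computable₂ h) :
    Computable fun a => (f a).foldl (fun s b => h a (s, b)) (g a) := by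
  have h1 : Computable fun a => (Nat.rec (g a) (fun n s => Option.casesOn ((f a)[n]?) s
      (fun b => h a (s, b))) (f a).length : σ) := by
    refine Computable.nat_rec (h := fun a p => Option.casesOn ((f a)[p.1]?) p.2
      (fun b => h a (p.2, b))) (Computable.list_length.comp hf) hg ?_
    refine Computable.option_casesOn (o := fun x : α × ℕ × σ => (f x.1)[x.2.1]?)
      (f := fun x => x.2.2) (g := fun x b => h x.1 (x.2.2, b)) ?_ ?_ ?_
    · exact Computable.list_getElem?.comp (hf.comp Computable.fst)
        (Computable.fst.comp Computable.snd)
    · exact Computable.snd.comp Computable.snd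
    · exact hh.comp (Computable.fst.comp Computable.fst)
        (Computable.pair (Computable.snd.comp (Computable.snd.comp Computable.fst)) Computable.snd)
  refine h1.of_eq fun a => ?_
  have h2 : ∀ n, (Nat.rec (g a) (fun n s => Option.casesOn ((f a)[n]?) s
      (fun b => h a (s, b))) n : σ) = ((f a).take n).foldl (fun s b => h a (s, b)) (g a) := by
    intro n
    induction n with
    | zero => simp
    | succ n ih =>
      rw [List.take_add_one, List.foldl_append, ← ih]
      simp only
      cases (f a)[n]? <;> rfl
  rw [h2, List.take_length]

theorem _root_.Computable.list_map {f : α → List β} {g : α → β → σ}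
    (hf : Computable f) (hg : Computable₂ g) : Computable fun a => (f a).map (g a) := by
  refine (Computable.list_foldl (h := fun a p => p.1 ++ [g a p.2]) hf (Computable.const [])
    ?_).of_eq fun a => ?_
  · exact Computable.list_concat.comp (Computable.fst.comp Computable.snd)
      (hg.comp Computable.fst (Computable.snd.comp Computable.snd))
  · have h : ∀ (l : List β) (r : List σ),
        l.foldl (fun s b => s ++ [g a b]) r = r ++ l.map (g a) := fun l => by
      induction l with
      | nil => simp
      | cons b l ih => intro r; rw [List.foldl_cons, ih]; simp
    exact h _ _

theorem _root_.Computable.list_sum_map {f : α → List β} {g : α → β → ℕ}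
    (hf : Computable f) (hg : Computable₂ g) : Computable fun a => ((f a).map (g a)).sum := by
  refine (Computable.list_foldl (h := fun a p => p.1 + g a p.2) hf (Computable.const 0)
    ?_).of_eq fun a => ?_
  · exact (Primrec.nat_add.to_comp).comp (Computable.fst.comp Computable.snd)
      (hg.comp Computable.fst (Computable.snd.comp Computable.snd))
  · rw [List.sum_eq_foldl, List.foldl_map]

theorem _root_.Computable.list_flatMap {f : α → List β} {g : α → β → List σ}
    (hf : Computable f) (hg : Computable₂ g) : Computable fun a => (f a).flatMap (g a) := by
  refine (Computable.list_foldl (h := fun a p => p.1 ++ g a p.2) hf (Computable.const [])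
    ?_).of_eq fun a => ?_
  · exact Computable.list_append.comp (Computable.fst.comp Computable.snd)
      (hg.comp Computable.fst (Computable.snd.comp Computable.snd))
  · simp [List.flatMap]

end

theorem _root_.Primrec.nat_two_pow : Primrec fun n : ℕ => 2 ^ n :=
  (Primrec.nat_rec₁ 1 (Primrec.nat_mul.comp (Primrec.snd) (Primrec.const 2)).to₂).of_eq fun n => by
    induction n with
    | zero => rfl
    | succ n ih => simp_all [pow_succ]

/-! ### Pinning down bits -/

/-- The bitstrings of a given length. -/
def strings : ℕ → List (List Bool)
  | 0 => [[]]
  | n + 1 => (strings n).flatMap fun σ => [σ ++ [false], σ ++ [true]]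

theorem mem_strings {n : ℕ} {σ : List Bool} : σ ∈ strings n ↔ σ.length = n := by
  induction n generalizing σ with
  | zero => simp [strings]
  | succ n ih =>
    simp only [strings, List.mem_flatMap, ih, List.mem_cons, List.not_mem_nil, or_false]
    constructor
    · rintro ⟨τ, rfl, rfl | rfl⟩ <;> simp
    · intro h
      have hne : σ ≠ [] := by rintro rfl; simp at h
      refine ⟨σ.dropLast, by simp [h], ?_⟩
      have := List.dropLast_append_getLast hne
      cases hx : σ.getLast hne <;> rw [hx] at this <;> simp [this]

theorem length_strings (n : ℕ) : (strings n).length = 2 ^ n := by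
  induction n with
  | zero => rfl
  | succ n ih => simp [strings, List.length_flatMap, ih, pow_succ]

theorem sum_strings_le {μ : List Bool → ℝ} (hμ : IsContinuousSemimeasure μ) (n : ℕ) :
    ((strings n).map μ).sum ≤ 1 := by
  induction n with
  | zero => simpa [strings] using hμ.nil_le_one
  | succ n ih =>
    refine le_trans ?_ ih
    rw [strings]
    generalize strings n = l
    induction l with
    | nil => simp
    | cons σ l ihl =>
      have := hμ.append_le σ
      simp at ihl ⊢
      linarith

theorem primrec_strings : Primrec strings := by
  refine (Primrec.nat_rec₁ (f := fun _ l => l.flatMap fun σ => [σ ++ [false], σ ++ [true]])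
    [[]] ?_).of_eq fun n => ?_
  · refine Primrec.list_flatMap Primrec.snd ?_
    exact Primrec.list_cons.comp (Primrec.list_append.comp Primrec.snd (Primrec.const _))
      (Primrec.list_cons.comp (Primrec.list_append.comp Primrec.snd (Primrec.const _))
        (Primrec.const _))
  · induction n with
    | zero => rfl
    | succ n ih => simp only [strings, ← ih]

/-- The strings of the list whose bit at a given position has a given value. -/
def pin (i : ℕ) (x : Bool) (l : List (List Bool)) : List (List Bool) :=
  l.filter fun σ => σ[i]? = some x

theorem primrec_pin : Primrec₂ fun (l : List (List Bool)) (z : ℕ × Bool) => pin z.1 z.2 l := by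
  have h : PrimrecRel fun (σ : List Bool) (z : ℕ × Bool) => σ[z.1]? = some z.2 :=
    Primrec.eq.comp (Primrec.list_getElem?.comp Primrec.fst (Primrec.fst.comp Primrec.snd))
      (Primrec.option_some.comp (Primrec.snd.comp Primrec.snd))
  exact h.listFilter

theorem sum_pin {R : Type*} [AddCommMonoid R] (f : List Bool → R) {i : ℕ}
    {l : List (List Bool)} (hl : ∀ σ ∈ l, i < σ.length) :
    ((pin i false l).map f).sum + ((pin i true l).map f).sum = (l.map f).sum := by
  induction l with
  | nil => simp [pin]
  | cons σ l ih =>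
    have ih' := ih fun τ hτ => hl τ (List.mem_cons_of_mem _ hτ)
    have hi := hl σ List.mem_cons_self
    simp only [pin] at ih' ⊢
    rw [List.map_cons, List.sum_cons, ← ih']
    cases hx : σ[i] <;> simp [hi, hx] <;> abel

/-- The number of bits that are available to the requirement with a given number. -/
def levelLength (e : ℕ) : ℕ := Nat.pair e (2 ^ (e + 1)) + 1

theorem primrec_levelLength : Primrec levelLength :=
  Primrec.succ.comp (Primrec₂.natPair.comp Primrec.id (Primrec.nat_two_pow.comp Primrec.succ))

/-! ### The search for light lists and its mass bounds -/

section
variable (A : ℕ → ℕ → List Bool → ℕ)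

/-- One step of the search for bits that make the strings light: when the current weight exceeds
the bound, the next bit is chosen on the lighter side. -/
def pinStep (e s : ℕ) (c : List Bool × List (List Bool)) : List Bool × List (List Bool) :=
  -- `A e s` will be `2 ^ (levelLength e + e)` times the approximation to `M`, rounded down; the
  -- threshold thus stands for the mass `2 ^ (-e)`.
  if (c.2.map (A e s)).sum ≤ 2 ^ levelLength e then c
  else if ((pin (Nat.pair e c.1.length) true c.2).map (A e s)).sum ≤
      ((pin (Nat.pair e c.1.length) false c.2).map (A e s)).sum then
    (c.1 ++ [true], pin (Nat.pair e c.1.length) true c.2)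
  else (c.1 ++ [false], pin (Nat.pair e c.1.length) false c.2)

/-- The chosen bits and the list of the strings that have these bits. -/
def pinned (e : ℕ) : ℕ → List Bool × List (List Bool)
  | 0 => ([], strings (levelLength e))
  | s + 1 => pinStep A e s (pinned e s)

variable {A}

theorem computable_pinStep (hA : Computable fun z : (ℕ × ℕ) × List Bool => A z.1.1 z.1.2 z.2) :
    Computable fun z : (ℕ × ℕ) × List Bool × List (List Bool) => pinStep A z.1.1 z.1.2 z.2 := by
  have hsum : Computable fun z : (ℕ × ℕ) × List (List Bool) => (z.2.map (A z.1.1 z.1.2)).sum := by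
    have hA' : Computable₂ fun (z : ℕ × ℕ) σ => A z.1 z.2 σ := hA
    have h : Computable₂ fun (z : (ℕ × ℕ) × List (List Bool)) σ => A z.1.1 z.1.2 σ :=
      hA'.comp (Computable.fst.comp Computable.fst) Computable.snd
    exact Computable.list_sum_map Computable.snd h
  have hle : Computable₂ fun a b : ℕ => decide (a ≤ b) := Primrec.nat_le.decide.to_comp
  have hes : Computable fun z : (ℕ × ℕ) × List Bool × List (List Bool) => z.1 := Computable.fst
  have hl : Computable fun z : (ℕ × ℕ) × List Bool × List (List Bool) => z.2.2 :=
    Computable.snd.comp Computable.snd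
  have hπ : Computable fun z : (ℕ × ℕ) × List Bool × List (List Bool) => z.2.1 :=
    Computable.fst.comp Computable.snd
  have hpin : ∀ x, Computable fun z : (ℕ × ℕ) × List Bool × List (List Bool) =>
      pin (Nat.pair z.1.1 z.2.1.length) x z.2.2 := by
    intro x
    have hpair := (Primrec₂.natPair.to_comp).comp (Computable.fst.comp hes)
      (Computable.list_length.comp hπ)
    have h := (Primrec₂.to_comp primrec_pin).comp hl (Computable.pair hpair (Computable.const x))
    exact h
  have hlight : Computable fun z : (ℕ × ℕ) × List Bool × List (List Bool) =>
      decide ((z.2.2.map (A z.1.1 z.1.2)).sum ≤ 2 ^ levelLength z.1.1) := by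
    have h1 := hsum.comp (Computable.pair hes hl)
    have h2 := Primrec.nat_two_pow.to_comp.comp
      (primrec_levelLength.to_comp.comp (Computable.fst.comp hes))
    have h := hle.comp h1 h2
    exact h
  have hside : Computable fun z : (ℕ × ℕ) × List Bool × List (List Bool) =>
      decide (((pin (Nat.pair z.1.1 z.2.1.length) true z.2.2).map (A z.1.1 z.1.2)).sum ≤
        ((pin (Nat.pair z.1.1 z.2.1.length) false z.2.2).map (A z.1.1 z.1.2)).sum) := by
    have h1 := hsum.comp (Computable.pair hes (hpin true))
    have h2 := hsum.comp (Computable.pair hes (hpin false))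
    have h := hle.comp h1 h2
    exact h
  have hnext : ∀ x, Computable fun z : (ℕ × ℕ) × List Bool × List (List Bool) =>
      (z.2.1 ++ [x], pin (Nat.pair z.1.1 z.2.1.length) x z.2.2) := fun x =>
    Computable.pair (Computable.list_concat.comp hπ (Computable.const x)) (hpin x)
  have hcond := Computable.cond hlight Computable.snd
    (Computable.cond hside (hnext true) (hnext false))
  refine Computable.of_eq hcond fun z => ?_
  simp only [pinStep, Bool.cond_decide]

theorem computable_pinned (hA : Computable fun z : (ℕ × ℕ) × List Bool => A z.1.1 z.1.2 z.2) :
    Computable fun z : ℕ × ℕ => pinned A z.1 z.2 := by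
  have h0 : Computable fun z : ℕ × ℕ => (([] : List Bool), strings (levelLength z.1)) :=
    Computable.pair (Computable.const [])
      (primrec_strings.to_comp.comp (primrec_levelLength.to_comp.comp Computable.fst))
  have hz : Computable fun y : (ℕ × ℕ) × ℕ × List Bool × List (List Bool) =>
      ((y.1.1, y.2.1), y.2.2) :=
    Computable.pair
      (Computable.pair (Computable.fst.comp Computable.fst) (Computable.fst.comp Computable.snd))
      (Computable.snd.comp Computable.snd)
  have hstep : Computable₂ fun (z : ℕ × ℕ) (y : ℕ × List Bool × List (List Bool)) =>
      pinStep A z.1 y.1 y.2 := by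
    have h := (computable_pinStep hA).comp hz
    exact h
  have hrec := Computable.nat_rec Computable.snd h0 hstep
  refine Computable.of_eq hrec ?_
  rintro ⟨e, s⟩
  induction s with
  | zero => rfl
  | succ s ih => rw [pinned, ← ih]

theorem pinned_fst_prefix (e : ℕ) {s s' : ℕ} (h : s ≤ s') :
    (pinned A e s).1 <+: (pinned A e s').1 := by
  induction s', h using Nat.le_induction with
  | base => exact List.prefix_refl _
  | succ n _ ih =>
    refine ih.trans ?_
    rw [pinned, pinStep]
    split_ifs <;> simp

/-- The list depends on `s` only through the fixed bits, so it settles as soon as they do. -/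
theorem pinned_snd (e s : ℕ) : (pinned A e s).2 = (strings (levelLength e)).filter fun σ =>
    ∀ j < (pinned A e s).1.length, σ[Nat.pair e j]? = (pinned A e s).1[j]? := by
  induction s with
  | zero => simp [pinned]
  | succ s ih =>
    have key : ∀ x, pin (Nat.pair e (pinned A e s).1.length) x (pinned A e s).2 =
        (strings (levelLength e)).filter fun σ => ∀ j < ((pinned A e s).1 ++ [x]).length,
          σ[Nat.pair e j]? = ((pinned A e s).1 ++ [x])[j]? := by
      intro x
      rw [ih, pin, List.filter_filter]
      refine List.filter_congr fun σ _ => ?_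
      rw [← Bool.decide_and, decide_eq_decide]
      simp only [List.length_append, List.length_singleton, Nat.forall_lt_succ_right]
      rw [and_comm]
      refine and_congr (forall₂_congr fun j hj => ?_) ?_
      · rw [List.getElem?_append_left hj]
      · simp
    rw [pinned, pinStep]
    split_ifs
    · exact ih
    · exact key _
    · exact key _

theorem mem_pinned {e s : ℕ} {σ : List Bool} : σ ∈ (pinned A e s).2 ↔
    σ.length = levelLength e ∧
      ∀ j < (pinned A e s).1.length, σ[Nat.pair e j]? = (pinned A e s).1[j]? := by
  rw [pinned_snd, List.mem_filter, mem_strings, decide_eq_true_iff]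

/-- Equality is included because the next bit is fixed at the index that counts the bits fixed so
far, for which only the bound `2 ^ (e + 1)` is known. -/
theorem pair_lt_levelLength {e j : ℕ} (hj : j ≤ 2 ^ (e + 1)) : Nat.pair e j < levelLength e := by
  refine Nat.lt_succ_of_le ?_
  rcases hj.lt_or_eq with h | rfl
  · exact (Nat.pair_lt_pair_right e h).le
  · exact le_rfl

variable {M : List Bool → ℝ}

/-- A bit is fixed only when the approximate weight exceeds `2 ^ levelLength e`. The discarded half
is the heavier one, so it weighs at least `2 ^ (levelLength e - 1)`, and its true mass is no smaller
because `A` approximates from below. As the total is `2 ^ (e + 1)` times that amount, at most `2 ^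
(e + 1)` bits get fixed. -/
theorem sum_pinned_add_le (hM : IsContinuousSemimeasure M)
    (hAM : ∀ e s σ, (A e s σ : ℝ) ≤ 2 ^ (levelLength e + e) * M σ) (e s : ℕ) :
    2 ^ (levelLength e + e) * ((pinned A e s).2.map M).sum +
      (pinned A e s).1.length * 2 ^ (levelLength e - 1) ≤ 2 ^ (levelLength e + e) := by
  induction s with
  | zero =>
    simpa [pinned] using sum_strings_le hM (levelLength e)
  | succ s ih =>
    set c := pinned A e s with hc
    have hpos : (0 : ℝ) < 2 ^ (levelLength e - 1) := by positivity
    have hpow : (2 : ℝ) ^ (levelLength e + e) = 2 ^ (e + 1) * 2 ^ (levelLength e - 1) := by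
      rw [← pow_add]; congr 1; simp [levelLength]; omega
    have hpow' : (2 : ℝ) ^ levelLength e = 2 * 2 ^ (levelLength e - 1) := by
      rw [← pow_succ']; congr 1
    have hlen : c.1.length ≤ 2 ^ (e + 1) := by
      have h0 : 0 ≤ (2 : ℝ) ^ (levelLength e + e) * (c.2.map M).sum :=
        mul_nonneg (by positivity) (List.sum_nonneg (by simpa using fun σ _ => hM.nonneg σ))
      have h1 : (c.1.length : ℝ) * 2 ^ (levelLength e - 1) ≤
          2 ^ (e + 1) * 2 ^ (levelLength e - 1) := by linarith
      exact_mod_cast le_of_mul_le_mul_right h1 hpos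
    have hmem : ∀ σ ∈ c.2, Nat.pair e c.1.length < σ.length := fun σ hσ => by
      rw [(mem_pinned.1 hσ).1]; exact pair_lt_levelLength hlen
    have hle : ∀ l : List (List Bool), (((l.map (A e s)).sum : ℕ) : ℝ) ≤
        2 ^ (levelLength e + e) * (l.map M).sum := by
      intro l
      rw [← List.sum_map_mul_left, Nat.cast_list_sum, List.map_map]
      exact List.sum_le_sum fun σ _ => hAM e s σ
    have hT := sum_pin (A e s) hmem
    have hR := sum_pin M hmem
    rw [pinned, pinStep, ← hc]
    have e1 : ∀ w w' : ℕ, ¬ (c.2.map (A e s)).sum ≤ 2 ^ levelLength e → w ≤ w' →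
        w + w' = (c.2.map (A e s)).sum → (2 : ℝ) ^ (levelLength e - 1) ≤ w' := by
      intro w w' h1 h2 h3
      have h4 : (2 : ℝ) ^ levelLength e ≤ (2 * w' : ℕ) := by
        exact_mod_cast (by omega : 2 ^ levelLength e ≤ 2 * w')
      push_cast at h4
      linarith
    split_ifs with h1 h2
    · exact ih
    · have := e1 _ _ h1 h2 (by rw [add_comm, hT])
      have := hle (pin (Nat.pair e c.1.length) false c.2)
      rw [← hR] at ih
      simp only [List.length_append, List.length_singleton]
      push_cast
      linarith
    · have := e1 _ _ h1 (not_le.1 h2).le hT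
      have := hle (pin (Nat.pair e c.1.length) true c.2)
      rw [← hR] at ih
      simp only [List.length_append, List.length_singleton]
      push_cast
      linarith

theorem exists_pinned_eq (hM : IsContinuousSemimeasure M)
    (hAM : ∀ e s σ, (A e s σ : ℝ) ≤ 2 ^ (levelLength e + e) * M σ) (e : ℕ) :
    ∃ s₀, ∀ s ≥ s₀, pinned A e s = pinned A e s₀ := by
  have hb : ∀ s, (pinned A e s).1.length ≤ 2 ^ (levelLength e + e) := by
    intro s
    have h := sum_pinned_add_le hM hAM e s
    have h0 : 0 ≤ (2 : ℝ) ^ (levelLength e + e) * ((pinned A e s).2.map M).sum :=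
      mul_nonneg (by positivity) (List.sum_nonneg (by simpa using fun σ _ => hM.nonneg σ))
    have h1 : (1 : ℝ) ≤ 2 ^ (levelLength e - 1) := one_le_pow₀ (by norm_num)
    have h2 : ((pinned A e s).1.length : ℝ) ≤
        (pinned A e s).1.length * 2 ^ (levelLength e - 1) :=
      le_mul_of_one_le_right (by positivity) h1
    exact_mod_cast (by linarith : ((pinned A e s).1.length : ℝ) ≤ 2 ^ (levelLength e + e))
  have hmono : Monotone fun s => (pinned A e s).1.length := fun s s' h =>
    (pinned_fst_prefix e h).length_le
  obtain ⟨s₀, hs₀⟩ := Nat.sSup_mem (Set.range_nonempty fun s => (pinned A e s).1.length)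
    ⟨_, by rintro _ ⟨s, rfl⟩; exact hb s⟩
  refine ⟨s₀, fun s hs => ?_⟩
  have hfst : (pinned A e s).1 = (pinned A e s₀).1 := by
    refine ((pinned_fst_prefix e hs).eq_of_length (le_antisymm (hmono hs) ?_)).symm
    change (pinned A e s).1.length ≤ (fun s => (pinned A e s).1.length) s₀
    rw [hs₀]
    exact le_csSup ⟨_, by rintro _ ⟨s, rfl⟩; exact hb s⟩ ⟨s, rfl⟩
  exact Prod.ext hfst (by rw [pinned_snd, pinned_snd, hfst])

/-- Once settled, the list passes the test of `pinStep` at every stage. Rounding down loses at most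
one unit per string, and there are at most `2 ^ levelLength e` strings, so the true weight is at
most twice the threshold in the limit. -/
theorem sum_pinned_le
    (hlim : ∀ e σ, ∀ δ > 0, ∀ᶠ s in atTop,
      2 ^ (levelLength e + e) * M σ - 1 - δ ≤ (A e s σ : ℝ))
    {e s₀ : ℕ} (hs₀ : ∀ s ≥ s₀, pinned A e s = pinned A e s₀) :
    2 ^ e * ((pinned A e s₀).2.map M).sum ≤ 2 := by
  set l := (pinned A e s₀).2 with hl
  have hlen : l.length ≤ 2 ^ levelLength e := by
    rw [hl, pinned_snd, ← length_strings]
    exact List.length_filter_le _ _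
  have hweight : ∀ s ≥ s₀, (l.map (A e s)).sum ≤ 2 ^ levelLength e := by
    intro s hs
    by_contra hcon
    have h1 := hs₀ (s + 1) (by omega)
    rw [pinned, hs₀ s hs, pinStep, if_neg hcon] at h1
    have h2 := congrArg (fun c => c.1.length) h1
    split_ifs at h2 <;> simp at h2
  have hall : ∀ δ > 0, 2 ^ (levelLength e + e) * (l.map M).sum ≤
      2 ^ levelLength e + l.length * (1 + δ) := by
    intro δ hδ
    have hev : ∀ᶠ s in atTop, ∀ σ ∈ l.toFinset,
        2 ^ (levelLength e + e) * M σ - 1 - δ ≤ (A e s σ : ℝ) :=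
      (eventually_all_finset _).2 fun σ _ => hlim e σ δ hδ
    obtain ⟨s, hs, hss⟩ := (hev.and (eventually_ge_atTop s₀)).exists
    have h1 : (((l.map (A e s)).sum : ℕ) : ℝ) ≤ 2 ^ levelLength e := by
      exact_mod_cast hweight s hss
    have h2 : (l.map fun σ => 2 ^ (levelLength e + e) * M σ - (1 + δ)).sum ≤
        (l.map fun σ => (A e s σ : ℝ)).sum :=
      List.sum_le_sum fun σ hσ => by
        have := hs σ (List.mem_toFinset.2 hσ)
        linarith
    have h3 : ∀ (l : List (List Bool)) (f : List Bool → ℝ) (c : ℝ),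
        (l.map fun σ => f σ - c).sum = (l.map f).sum - l.length * c := by
      intro l f c
      induction l with
      | nil => simp
      | cons a l ih => simp only [List.map_cons, List.sum_cons, ih, List.length_cons]; push_cast; ring
    rw [h3, List.sum_map_mul_left] at h2
    rw [Nat.cast_list_sum, List.map_map] at h1
    have h4 : (l.map (Nat.cast ∘ A e s) : List ℝ).sum = (l.map fun σ => (A e s σ : ℝ)).sum := rfl
    linarith
  have hlen' : (l.length : ℝ) ≤ 2 ^ levelLength e := by exact_mod_cast hlen
  have hfin : 2 ^ (levelLength e + e) * (l.map M).sum ≤ 2 ^ levelLength e + l.length := by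
    refine le_of_forall_pos_le_add fun ε hε => ?_
    have hp : (0 : ℝ) < l.length + 1 := by positivity
    have h5 := hall (ε / (l.length + 1)) (by positivity)
    have h6 : l.length * (ε / (l.length + 1)) ≤ ε := by
      rw [mul_div_assoc', div_le_iff₀ hp]; nlinarith
    linarith
  have hpos : (0 : ℝ) < 2 ^ levelLength e := by positivity
  rw [pow_add] at hfin
  refine le_of_mul_le_mul_left ?_ hpos
  linarith

end

/-- Against a lower semicomputable continuous semimeasure `M` there are uniformly computable lists
of bitstrings that all contain a prefix of the same infinite sequence, such that for each `e` the
list with the numbers `e, s` has mass `2 ^ (1 - e)` at most when `s` is large, and is then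
independent of `s`. -/
theorem exists_light_lists {M : List Bool → ℝ} (hM : IsContinuousSemimeasure M)
    (hMc : LowerSemicomputable M) :
    ∃ (Ψ : ℕ × ℕ → List (List Bool)) (X : ℕ → Bool), Computable Ψ ∧
      (∀ z, ∀ σ ∈ Ψ z, σ ≠ []) ∧ (∀ z, ∃ n, (List.range n).map X ∈ Ψ z) ∧
      ∀ e, ∃ s₀, (∀ s ≥ s₀, Ψ (e, s) = Ψ (e, s₀)) ∧ 2 ^ e * ((Ψ (e, s₀)).map M).sum ≤ 2 := by
  obtain ⟨p, q, hp, hq, hpq⟩ := hMc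
  let A : ℕ → ℕ → List Bool → ℕ := fun e s σ =>
    2 ^ (levelLength e + e) * p (σ, s) / (q (σ, s) + 1)
  have hA : Computable fun z : (ℕ × ℕ) × List Bool => A z.1.1 z.1.2 z.2 := by
    have hσs : Computable fun z : (ℕ × ℕ) × List Bool => (z.2, z.1.2) :=
      Computable.pair Computable.snd (Computable.snd.comp Computable.fst)
    have he : Computable fun z : (ℕ × ℕ) × List Bool => z.1.1 :=
      Computable.fst.comp Computable.fst
    exact Primrec.nat_div.to_comp.comp
      (Primrec.nat_mul.to_comp.comp
        (Primrec.nat_two_pow.to_comp.comp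
          (Primrec.nat_add.to_comp.comp (primrec_levelLength.to_comp.comp he) he))
        (hp.comp hσs))
      (Computable.succ.comp (hq.comp hσs))
  have hAdiv : ∀ e s σ, (A e s σ : ℝ) ≤
        2 ^ (levelLength e + e) * ((p (σ, s) : ℝ) / ((q (σ, s) : ℝ) + 1)) ∧
      2 ^ (levelLength e + e) * ((p (σ, s) : ℝ) / ((q (σ, s) : ℝ) + 1)) ≤ A e s σ + 1 := by
    intro e s σ
    have hc : ((2 ^ (levelLength e + e) * p (σ, s) : ℕ) : ℝ) / ((q (σ, s) + 1 : ℕ) : ℝ) =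
        2 ^ (levelLength e + e) * ((p (σ, s) : ℝ) / ((q (σ, s) : ℝ) + 1)) := by
      push_cast; rw [mul_div_assoc]
    rw [← hc]
    refine ⟨Nat.cast_div_le, ?_⟩
    rw [div_le_iff₀ (by positivity)]
    exact_mod_cast (Nat.lt_mul_of_div_lt (Nat.lt_succ_self _) (Nat.succ_pos _)).le
  have hAM : ∀ e s σ, (A e s σ : ℝ) ≤ 2 ^ (levelLength e + e) * M σ := fun e s σ =>
    (hAdiv e s σ).1.trans (mul_le_mul_of_nonneg_left
      ((hpq σ).1.ge_of_tendsto (hpq σ).2 s) (by positivity))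
  have hlim : ∀ e σ, ∀ δ > 0, ∀ᶠ s in atTop,
      2 ^ (levelLength e + e) * M σ - 1 - δ ≤ (A e s σ : ℝ) := by
    intro e σ δ hδ
    filter_upwards [((hpq σ).2.const_mul (2 ^ (levelLength e + e))).eventually_const_lt
      (sub_lt_self _ hδ)] with s hs
    have := (hAdiv e s σ).2
    linarith
  choose s₀ hs₀ using exists_pinned_eq hM hAM
  -- Different requirements own disjoint sets of positions, so their final bits fit into one
  -- sequence; positions never fixed get `false`.
  let X : ℕ → Bool := fun i => ((pinned A i.unpair.1 (s₀ i.unpair.1)).1[i.unpair.2]?).getD false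
  refine ⟨fun z => (pinned A z.1 z.2).2, X, Computable.snd.comp (computable_pinned hA), ?_, ?_,
    fun e => ⟨s₀ e, fun s hs => congrArg Prod.snd (hs₀ e s hs), sum_pinned_le hlim (hs₀ e)⟩⟩
  · rintro ⟨e, s⟩ σ hσ rfl
    simpa [levelLength] using (mem_pinned.1 hσ).1
  · rintro ⟨e, s⟩
    refine ⟨levelLength e, mem_pinned.2 ⟨by simp, fun j hj => ?_⟩⟩
    -- At every stage the bits fixed so far are an initial part of the final ones, so the prefix of
    -- `X` satisfies the constraints of unsettled lists as well.
    have hpre : (pinned A e s).1 <+: (pinned A e (s₀ e)).1 := by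
      rcases le_total s (s₀ e) with h | h
      · exact pinned_fst_prefix e h
      · rw [hs₀ e s h]
    have hlen : j ≤ 2 ^ (e + 1) := by
      have h := sum_pinned_add_le hM hAM e s
      have h0 : 0 ≤ (2 : ℝ) ^ (levelLength e + e) * ((pinned A e s).2.map M).sum :=
        mul_nonneg (by positivity) (List.sum_nonneg (by simpa using fun σ _ => hM.nonneg σ))
      have hpow : (2 : ℝ) ^ (levelLength e + e) = 2 ^ (e + 1) * 2 ^ (levelLength e - 1) := by
        rw [← pow_add]; congr 1; simp [levelLength]; omega
      have h1 : ((pinned A e s).1.length : ℝ) * 2 ^ (levelLength e - 1) ≤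
          2 ^ (e + 1) * 2 ^ (levelLength e - 1) := by linarith
      have h2 : (pinned A e s).1.length ≤ 2 ^ (e + 1) := by
        exact_mod_cast le_of_mul_le_mul_right h1 (by positivity)
      exact hj.le.trans h2
    have hget : (pinned A e (s₀ e)).1[j]? = (pinned A e s).1[j]? := by
      rw [List.getElem?_eq_getElem hj, List.prefix_iff_getElem?.1 hpre j hj]
    rw [List.getElem?_map, List.getElem?_range (pair_lt_levelLength hlen), Option.map_some]
    simp only [X, Nat.unpair_pair, hget, List.getElem?_eq_getElem hj, Option.getD_some]

section
variable {L : PropLanguage} {b : ℕ → L.prime}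

/-! ### The strings of the sentences about initial segments -/

/-- The conjunctions nest to the left, so in Polish notation all the connectives come first. This
makes the string computable by operations on lists, without recursion on sentences. -/
theorem code_conjLiterals (b : ℕ → L.prime) (φ : Sentence L) (i : ℕ) (σ : List Bool) :
    (conjLiterals b φ i σ).code = List.replicate σ.length Token.and ++ (φ.code ++
      (List.range σ.length).flatMap fun j => (literal b (i + j) (σ[j]?.getD false)).code) := by
  induction σ generalizing φ i with
  | nil => simp [conjLiterals]
  | cons x σ ih =>
    rw [conjLiterals, ih, List.length_cons, List.range_succ_eq_map, List.flatMap_cons,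
      List.flatMap_map, List.replicate_succ']
    simp [Sentence.code, Nat.add_assoc, Nat.add_comm 1]

theorem code_startsWith (b : ℕ → L.prime) {σ : List Bool} (hσ : σ ≠ []) :
    (startsWith b σ).code = List.replicate (σ.length - 1) Token.and ++
      (List.range σ.length).flatMap fun j => (literal b j (σ[j]?.getD false)).code := by
  obtain ⟨x, σ, rfl⟩ := List.exists_cons_of_ne_nil hσ
  rw [startsWith, code_conjLiterals, List.length_cons, List.range_succ_eq_map, List.flatMap_cons,
    List.flatMap_map]
  simp [Nat.add_comm 1]

theorem computable_code_literal (hb : Computable fun i => (b i : List Bool)) :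
    Computable fun z : ℕ × Bool => (literal b z.1 z.2).code := by
  have hbit : Primrec bitCode := Primrec.dom_finite _
  have h1 := Computable.list_map (hb.comp (Computable.fst (α := ℕ) (β := Bool)))
    (hbit.to_comp.comp Computable.snd).to₂
  have h2 := Computable.list_cons.comp (Computable.const Token.prime)
    (Computable.list_concat.comp h1 (Computable.const Token.done))
  have h3 := Computable.list_cons.comp (Computable.const Token.neg) h2
  refine (Computable.cond Computable.snd h2 h3).of_eq ?_
  rintro ⟨i, _ | _⟩ <;> rfl

theorem computable_code_startsWith (hb : Computable fun i => (b i : List Bool)) :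
    Computable fun σ : List Bool => List.replicate (σ.length - 1) Token.and ++
      (List.range σ.length).flatMap fun j => (literal b j (σ[j]?.getD false)).code := by
  have h1 : Computable fun σ : List Bool => List.replicate (σ.length - 1) Token.and :=
    (Computable.list_map (Primrec.list_range.to_comp.comp
      (Computable.pred.comp Computable.list_length)) (Computable.const Token.and).to₂).of_eq
        fun σ => by simp
  have h2 : Computable fun z : List Bool × ℕ => z.1[z.2]?.getD false :=
    Computable.option_getD (Computable.list_getElem?.comp Computable.fst Computable.snd)
      (Computable.const false)
  have h3 := (computable_code_literal hb).comp (Computable.pair Computable.snd h2)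
  have h4 := Computable.list_flatMap
    (Primrec.list_range.to_comp.comp Computable.list_length) h3.to₂
  exact Computable.list_append.comp h1 h4

theorem computable_map_code_startsWith (hb : Computable fun i => (b i : List Bool))
    {Ψ : ℕ → List (List Bool)} (hΨ : Computable Ψ) (hne : ∀ k, ∀ σ ∈ Ψ k, σ ≠ []) :
    Computable fun k => ((Ψ k).map (startsWith b)).map Sentence.code := by
  have h1 := (computable_code_startsWith hb).comp (Computable.snd (α := ℕ))
  refine Computable.of_eq (Computable.list_map hΨ h1.to₂) fun k => ?_
  rw [List.map_map]
  exact List.map_congr_left fun σ hσ => (code_startsWith b (hne k σ hσ)).symm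

/-! ### Worlds with prescribed atoms -/

/-- The truth value of a sentence under an assignment of truth values to the prime sentences. -/
def Sentence.truth (v : L.prime → Bool) : Sentence L → Bool
  | .prime p => v p
  | .neg φ => !φ.truth v
  | .and φ ψ => φ.truth v && ψ.truth v
  | .or φ ψ => φ.truth v || ψ.truth v
  | .imp φ ψ => !φ.truth v || ψ.truth v
  | .iff φ ψ => φ.truth v == ψ.truth v

theorem isPC_truth (v : L.prime → Bool) : World.IsPC fun φ : Sentence L => φ.truth v :=
  ⟨fun _ => rfl, fun _ _ => rfl, fun _ _ => rfl, fun _ _ => rfl, fun _ _ => rfl⟩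

theorem World.IsPC.truth_eq {W : World L} (hW : W.IsPC) {v : L.prime → Bool} {φ : Sentence L}
    (h : ∀ p, φ.Mentions p → v p = W (.prime p)) : φ.truth v = W φ := by
  induction φ with
  | prime p => exact h p rfl
  | neg φ ih => rw [hW.neg, ← ih h]; rfl
  | and φ ψ ih ih' =>
    rw [hW.and, ← ih fun p hp => h p (Or.inl hp), ← ih' fun p hp => h p (Or.inr hp)]; rfl
  | or φ ψ ih ih' =>
    rw [hW.or, ← ih fun p hp => h p (Or.inl hp), ← ih' fun p hp => h p (Or.inr hp)]; rfl
  | imp φ ψ ih ih' =>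
    rw [hW.imp, ← ih fun p hp => h p (Or.inl hp), ← ih' fun p hp => h p (Or.inr hp)]; rfl
  | iff φ ψ ih ih' =>
    rw [hW.iff, ← ih fun p hp => h p (Or.inl hp), ← ih' fun p hp => h p (Or.inr hp)]; rfl

theorem truth_conjLiterals {v : L.prime → Bool} {φ : Sentence L} (hφ : φ.truth v = true) (i n : ℕ) :
    (conjLiterals b φ i ((List.range n).map fun j => v (b (i + j)))).truth v = true := by
  induction n generalizing φ i with
  | zero => simpa [conjLiterals] using hφ
  | succ n ih =>
    rw [List.range_succ_eq_map, List.map_cons, List.map_map, conjLiterals]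
    have hl : (literal b i (v (b i))).truth v = true := by
      cases h : v (b i) <;> simp [literal, Sentence.truth, h]
    have := ih (φ := .and φ (literal b i (v (b i)))) (by simp [Sentence.truth, hφ, hl]) (i + 1)
    simpa [Function.comp_def, Nat.add_assoc, Nat.add_comm 1] using this

theorem truth_startsWith (v : L.prime → Bool) (n : ℕ) :
    (startsWith b ((List.range n).map fun j => v (b j))).truth v = true := by
  cases n with
  | zero => simp [startsWith, Sentence.truth]
  | succ n =>
    rw [List.range_succ_eq_map, List.map_cons, List.map_map, startsWith]
    have hl : (literal b 0 (v (b 0))).truth v = true := by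
      cases h : v (b 0) <;> simp [literal, Sentence.truth, h]
    simpa [Function.comp_def, Nat.add_comm 1] using truth_conjLiterals (b := b) hl 1 n

/-- Atoms that do not occur in a consistent theory can be given any truth values. -/
theorem exists_mem_pcWorlds_startsWith {Γ : Set (Sentence L)} (hΓ : Consistent Γ)
    (hb : Function.Injective b) (hfree : ∀ i, ∀ φ ∈ Γ, ¬ φ.Mentions (b i)) (X : ℕ → Bool) :
    ∃ W ∈ pcWorlds Γ, ∀ n, W (startsWith b ((List.range n).map X)) = true := by
  obtain ⟨W, hW, hWΓ⟩ := hΓ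
  let v : L.prime → Bool := Function.extend b X fun p => W (.prime p)
  have hv : ∀ j, v (b j) = X j := fun j => hb.extend_apply _ _ _
  refine ⟨fun φ => φ.truth v, ⟨isPC_truth v, fun φ hφ => ?_⟩, fun n => ?_⟩
  · change φ.truth v = true
    rw [hW.truth_eq, hWΓ φ hφ]
    refine fun p hp => Function.extend_apply' _ _ _ ?_
    rintro ⟨i, rfl⟩
    exact hfree i φ hφ hp
  · have h := truth_startsWith (b := b) v n
    simp only [hv] at h
    exact h

theorem pcWorlds_anti {Δ Δ' : Set (Sentence L)} (h : Δ ⊆ Δ') : pcWorlds Δ' ⊆ pcWorlds Δ :=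
  fun _ hW => ⟨hW.1, fun φ hφ => hW.2 φ (h hφ)⟩

/-! ### Limiting prices of the light lists -/

theorem tendsto_sum_map {ι : Type*} (l : List ι) {f : ℕ → ι → ℝ} {g : ι → ℝ}
    (h : ∀ a, Tendsto (fun n => f n a) atTop (𝓝 (g a))) :
    Tendsto (fun n => (l.map (f n)).sum) atTop (𝓝 (l.map g).sum) := by
  induction l with
  | nil => simp
  | cons a l ih => simpa using (h a).add ih

/-- The limiting prices of a logical inductor are not dominated by a lower semicomputable
continuous semimeasure. -/
theorem IsLogicalInductor.exists_lt_of_lowerSemicomputable {P : ℕ → Sentence L → ℚ}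
    {D : ℕ → Finset (Sentence L)} (hP : IsLogicalInductor P D) {Γ : Set (Sentence L)}
    (hD : IsComplete D Γ) (hΓ : Consistent Γ) (hb : Function.Injective b)
    (hbc : Computable fun i => (b i : List Bool)) (hfree : ∀ i, ∀ φ ∈ Γ, ¬ φ.Mentions (b i))
    {M : List Bool → ℝ} (hM : IsContinuousSemimeasure M) (hMc : LowerSemicomputable M)
    {Q : Sentence L → ℝ} (hQ : ∀ φ, Tendsto (fun n => (P n φ : ℝ)) atTop (𝓝 (Q φ)))
    {C : ℝ} (hC : 0 < C) : ∃ σ : List Bool, σ ≠ [] ∧ C * M σ < Q (startsWith b σ) := by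
  by_contra! hcon
  obtain ⟨Ψ, X, hΨ, hne, hX, hlight⟩ := exists_light_lists hM hMc
  obtain ⟨W, hWΓ, hW⟩ := exists_mem_pcWorlds_startsWith hΓ hb hfree X
  have hWD : ∀ n, W ∈ pcWorlds (D n : Set (Sentence L)) := fun n =>
    pcWorlds_anti (Set.subset_iUnion (fun n => (D n : Set (Sentence L))) n) (hD ▸ hWΓ)
  have htrue : ∀ k, ∃ φ ∈ (Ψ (Nat.unpair k)).map (startsWith b), W φ = true := fun k => by
    obtain ⟨n, hn⟩ := hX (Nat.unpair k)
    exact ⟨_, List.mem_map_of_mem hn, hW n⟩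
  obtain ⟨κ, hκ, ε, hε, hev⟩ := hP.exists_le_sum_price hWD
    (Φ := fun k => (Ψ (Nat.unpair k)).map (startsWith b))
    (computable_map_code_startsWith hbc (hΨ.comp Computable.unpair) fun k => hne _) htrue
  -- `ε` does not depend on the list, so `e` may be chosen after it, with `C * 2 ^ (1 - e) < ε`.
  obtain ⟨e, he⟩ := pow_unbounded_of_one_lt (2 * C / ε) (by norm_num : (1 : ℝ) < 2)
  obtain ⟨s₀, hs₀, hmass⟩ := hlight e
  set l := (Ψ (e, s₀)).map (startsWith b) with hl
  have hfreq : ∃ᶠ n in atTop, ε ≤ (l.map fun φ => (P n φ : ℝ)).sum := by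
    -- Surjectivity of `κ` only guarantees one day for each index, but the settled list has
    -- infinitely many indices `Nat.pair e s`, hence infinitely many days.
    have h1 : {n | ∃ s ≥ s₀, κ n = Nat.pair e s}.Infinite := by
      have h2 : (Set.range fun t => Nat.pair e (s₀ + t)).Infinite :=
        Set.infinite_range_of_injective fun t t' h => by
          simpa [Nat.pair_eq_pair] using h
      refine Set.Infinite.of_image κ (h2.mono ?_)
      rintro _ ⟨t, rfl⟩
      obtain ⟨n, hn⟩ := hκ (Nat.pair e (s₀ + t))
      exact ⟨n, ⟨s₀ + t, Nat.le_add_right _ _, hn⟩, hn⟩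
    refine ((Nat.frequently_atTop_iff_infinite.2 h1).and_eventually hev).mono ?_
    rintro n ⟨⟨s, hs, hn⟩, hle⟩
    simpa only [hn, Nat.unpair_pair, hs₀ s hs] using hle
  have hlim := tendsto_sum_map l hQ
  have h1 : ε ≤ (l.map Q).sum := ge_of_tendsto_of_frequently hlim hfreq
  have h2 : (l.map Q).sum ≤ C * ((Ψ (e, s₀)).map M).sum := by
    rw [hl, List.map_map, ← List.sum_map_mul_left]
    exact List.sum_le_sum fun σ hσ => hcon σ (hne _ σ hσ)
  rw [div_lt_iff₀ hε] at he
  have h3 : (2 : ℝ) ^ e * ε ≤ 2 ^ e * (C * ((Ψ (e, s₀)).map M).sum) :=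
    mul_le_mul_of_nonneg_left (h1.trans h2) (by positivity)
  have h4 : C * (2 ^ e * ((Ψ (e, s₀)).map M).sum) ≤ C * 2 := mul_le_mul_of_nonneg_left hmass hC.le
  linarith

end

end LogicalInduction

theorem mainTheorem9 (L : LogicalInduction.PropLanguage)
    (Γ : Set (LogicalInduction.Sentence L))
    (hΓce : LogicalInduction.IsCE Γ) (hΓcons : LogicalInduction.Consistent Γ)
    (P : ℕ → LogicalInduction.Sentence L → ℚ)
    (hP : LogicalInduction.IsLogicalInductorOver P Γ)
    (b : ℕ → L.prime) (hb_inj : Function.Injective b)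
    (hb_comp : Computable (fun i => (b i : List Bool)))
    (hb_free : ∀ i, ∀ φ ∈ Γ, ¬ φ.Mentions (b i))
    (M : List Bool → ℝ) (hM : LogicalInduction.IsUniversalSemimeasure M) :
    ∃ Pinf : LogicalInduction.Sentence L → ℝ,
      (∀ φ, Filter.Tendsto (fun n => (P n φ : ℝ)) Filter.atTop (nhds (Pinf φ))) ∧
      ∀ C : ℝ, 0 < C →
        ∃ σ : List Bool, σ ≠ [] ∧ C * M σ < Pinf (LogicalInduction.startsWith b σ) := by
  obtain ⟨D, -, hDΓ, hPD⟩ := hP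
  obtain ⟨W, hW⟩ := id hΓcons
  have hWD : ∀ n, W ∈ LogicalInduction.pcWorlds (D n : Set (LogicalInduction.Sentence L)) :=
    fun n => LogicalInduction.pcWorlds_anti
      (Set.subset_iUnion (fun n => (D n : Set (LogicalInduction.Sentence L))) n) (hDΓ ▸ hW)
  choose Q hQ using fun φ => hPD.exists_tendsto hWD φ
  exact ⟨Q, hQ, fun C hC => hPD.exists_lt_of_lowerSemicomputable hDΓ hΓcons hb_inj hb_comp hb_free
    hM.semimeasure hM.lowerSemicomputable hQ hC⟩
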